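/- **Setting.** Let $\mathbb P$ be a set of propositional variables. An *assignment* is a non-empty finite partial function $\alpha$ from $\mathbb P$ to $\{\top,\bot\}$. Formulas and programs of DL-PA are given by $\phi ::= p\mid\neg\phi\mid\phi\wedge\phi\mid[\pi]\phi$ and $\pi::=\alpha\mid\pi;\pi\mid\pi\cup\pi\mid\pi^*\mid\phi?$; *star-free* means without $\pi^*$. A model is a set $V\subseteq\mathbb P$, and $V\models\phi$ is the usual PDL semantics in which $\alpha$ leads from $V$ to $V^\alpha=\{p:\alpha(p)=\top\}\cup(V\setminus\operatorname{dom}\alpha)$. The length $\operatorname{len}(\phi)$ is the number of occurrences of connectives ($\neg,\wedge,[\cdot],;,\cup,{}^*,?$) and of variables, where an occurrence of $\alpha$ contributes $|\operatorname{dom}\alpha|$. More generally, if a name $p$ occupies $\nu(p)\ge 1$ symbols, $\operatorname{size}_\nu(\phi)$ counts each occurrence of $p$ as $\nu(p)$ instead of $1$; $\operatorname{size}_\nu(\alpha)=\sum_{p\in\operatorname{dom}\alpha}\nu(p)$. A *labelled formula* $\langle\sigma,\phi\rangle$ consists of a finite sequence $\sigma$ of assignments and a formula; a *branch* is a finite set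 of labelled formulas. The tableau rules generate from a witness in a branch $b$ one or more branches to be added to $b$: * *single local rules* (all with label $\sigma$): $\neg\neg\phi\mapsto\{\phi\}$; $\phi\wedge\psi\mapsto\{\phi,\psi\}$; $\neg[\psi?]\phi\mapsto\{\psi,\neg\phi\}$; $[\pi_1;\pi_2]\phi\mapsto\{[\pi_1][\pi_2]\phi\}$; $\neg[\pi_1;\pi_2]\phi\mapsto\{\neg[\pi_1][\pi_2]\phi\}$; $[\pi_1\cup\pi_2]\phi\mapsto\{[\pi_1]\phi,[\pi_2]\phi\}$; * *splitting local rules* (same label): $\neg(\phi\wedge\psi)\mapsto\{\neg\phi\}\mid\{\neg\psi\}$; $[\psi?]\phi\mapsto\{\neg\psi\}\mid\{\phi\}$; $\neg[\pi_1\cup\pi_2]\phi\mapsto\{\neg[\pi_1]\phi\}\mid\{\neg[\pi_2]\phi\}$; and the closing rule: if $\langle\sigma,\phi\rangle,\langle\sigma,\neg\phi\rangle\in b$, then $\langle\sigma,\phi\rangle$ is a witness and no branch is generated; * *successor rules*: $\langle\sigma,[\alpha]\phi\rangle$ (resp. $\langle\sigma,\neg[\alpha]\phi\rangle$) generates $\langle\sigma\alpha,\phi\rangle$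 (resp. $\langle\sigma\alpha,\neg\phi\rangle$) together with $\langle\sigma\alpha,p\rangle$ for $\alpha(p)=\top$ and $\langle\sigma\alpha,\neg p\rangle$ for $\alpha(p)=\bot$; * *propagation rules*: if $\langle\sigma,\ell\rangle\in b$ for a literal $\ell\in\{p,\neg p\}$, some $\langle\sigma\alpha,\psi\rangle\in b$ and $p\notin\operatorname{dom}\alpha$, then $\langle\sigma\alpha,\ell\rangle$ is generated. **The algorithm.** On input $(V,\phi_0)$ with $\phi_0$ star-free, call $\mathrm{mcTableau}(b_0)$, where $b_0$ consists of $\langle(),\phi_0\rangle$ and, for every variable $p$ occurring in $\phi_0$, of $\langle(),p\rangle$ if $p\in V$ and $\langle(),\neg p\rangle$ otherwise. Labelled formulas of a branch can be marked non-applicable; a marked formula is no longer an applicable witness to a local or successor rule. A recursive call gets its own copy of its argument, including the marks if the argument extends $b$. $\mathrm{mcTableau}(b)$ does the following: 1. If there is an applicable witness to a single local rule, choose one, mark it, and return $\mathrm{mcTableau}(b\cup b_1)$, $b_1$ being the generated branch. 2. Otherwise, if there is an applicable witness to a splitting local rule, choose one and mark it; for each generated $b_i$, in any order, call $\mathrm{mcTableau}(b\cup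 b_i)$ and return **true** as soon as a call returns **true**; if none does, return **false**. 3. Otherwise, as long as there is an applicable witness $\langle\sigma,[\alpha]\psi\rangle$ or $\langle\sigma,\neg[\alpha]\psi\rangle$ to a successor rule: choose one and mark it; let $b_1$ be the branch generated by it and by all the other applicable witnesses with the same $\sigma$ and $\alpha$, which are marked too; propagate to $b_1$ all the literals of $b$ to which the propagation rules apply (each literal being used once per successor); call $\mathrm{mcTableau}(b_1)$ without marks and return **false** if this call returns **false**. 4. Return **true**. **Memory.** At each moment of an execution, the memory in use consists of the activation records of all the calls of $\mathrm{mcTableau}$ that are still open. Each record holds its branch $b$, its set of marked formulas and its current local variables (the generated branches still to be treated or in use, the current witness, the literals already propagated), plus one unit of overhead; there is one further unit of overhead in total. It is measured in two ways: in *labelled formulas*, where a stored labelled formula counts $1$; and in *symbols*, where a stored $\langle\alpha_1\cdots\alpha_n,\psi\rangle$ counts $1+\sum_i\operatorname{size}_\nu(\alpha_i)+\operatorname{size}_\nu(\psi)$. **Theorem (Complexity).** There is a constant $C\in\mathbb N$ such that, for every $\mathbb P$, every $V\subseteq\mathbb P$ and every star-free formula $\phi_0$: 1. every execution of the algorithm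 on $(V,\phi_0)$, whatever witnesses are chosen, halts, and it returns **true** if and only if $V\models\phi_0$; 2. at every moment of every execution, the memory in use is at most $C\operatorname{len}(\phi_0)^3$ labelled formulas; 3. at every moment of every execution, and for every $\nu:\mathbb P\to\mathbb N$ with $\nu\ge1$, the memory in use is at most $C\operatorname{len}(\phi_0)^3\operatorname{size}_\nu(\phi_0)$ symbols. In particular, the algorithm is a decision procedure for star-free DL-PA model checking whose memory is polynomially bounded in the length of the input. -/

import Mathlib

universe u

noncomputable section

namespace DLPA

/-! ## Syntax -/

/-- A propositional assignment: a non-empty finite partial function from `P` to truth values,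
given by its graph. -/
@[ext]
structure Assign (P : Type u) where
  graph : Finset (P × Bool)
  functional : ∀ p v w, (p, v) ∈ graph → (p, w) ∈ graph → v = w
  nonempty : graph.Nonempty

/-- The domain of an assignment. -/
def Assign.dom {P : Type u} (α : Assign P) : Set P := {p | ∃ v, (p, v) ∈ α.graph}

mutual
/-- Formulas of the full language. -/
inductive Form (P : Type u) : Type u where
  | var : P → Form P
  | neg : Form P → Form P
  | and : Form P → Form P → Form P
  | box : Prog P → Form P → Form P
/-- Programs of the full language. -/
inductive Prog (P : Type u) : Type u where
  | assign : Assign P → Prog P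
  | seq : Prog P → Prog P → Prog P
  | choice : Prog P → Prog P → Prog P
  | star : Prog P → Prog P
  | test : Form P → Prog P
end

mutual
/-- Membership in the star-free fragment. -/
def Form.StarFree {P : Type u} : Form P → Prop
  | .var _ => True
  | .neg φ => φ.StarFree
  | .and φ ψ => φ.StarFree ∧ ψ.StarFree
  | .box π φ => π.StarFree ∧ φ.StarFree
/-- Programs without the Kleene star. -/
def Prog.StarFree {P : Type u} : Prog P → Prop
  | .assign _ => True
  | .seq π₁ π₂ => π₁.StarFree ∧ π₂.StarFree
  | .choice π₁ π₂ => π₁.StarFree ∧ π₂.StarFree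
  | .star _ => False
  | .test φ => φ.StarFree
end

/-- The size of an assignment when an occurrence of the variable `p` has size `ν p`. -/
def Assign.size {P : Type u} (ν : P → ℕ) (α : Assign P) : ℕ := ∑ x ∈ α.graph, ν x.1

mutual
/-- The size of a formula: the number of occurrences of connectives plus the sizes of the
occurrences of variables, where an occurrence of `p` has size `ν p`. -/
def Form.size {P : Type u} (ν : P → ℕ) : Form P → ℕ
  | .var p => ν p
  | .neg φ => 1 + φ.size ν
  | .and φ ψ => 1 + φ.size ν + ψ.size ν
  | .box π φ => 1 + π.size ν + φ.size ν
/-- The size of a program. -/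
def Prog.size {P : Type u} (ν : P → ℕ) : Prog P → ℕ
  | .assign α => α.size ν
  | .seq π₁ π₂ => 1 + π₁.size ν + π₂.size ν
  | .choice π₁ π₂ => 1 + π₁.size ν + π₂.size ν
  | .star π => 1 + π.size ν
  | .test φ => 1 + φ.size ν
end

/-- The length of a formula: every occurrence of a variable counts `1`. In particular an
assignment counts the number of elements of its domain. -/
def Form.len {P : Type u} (φ : Form P) : ℕ := φ.size fun _ => 1

open Classical in
mutual
/-- The propositional variables that occur in a formula (in assignments as well). -/
def Form.vars {P : Type u} : Form P → Finset P
  | .var p => {p}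
  | .neg φ => φ.vars
  | .and φ ψ => φ.vars ∪ ψ.vars
  | .box π φ => π.vars ∪ φ.vars
/-- The propositional variables that occur in a program. -/
def Prog.vars {P : Type u} : Prog P → Finset P
  | .assign α => α.graph.image Prod.fst
  | .seq π₁ π₂ => π₁.vars ∪ π₂.vars
  | .choice π₁ π₂ => π₁.vars ∪ π₂.vars
  | .star π => π.vars
  | .test φ => φ.vars
end

/-! ## Semantics -/

/-- The update of a model by an assignment. -/
def Assign.update {P : Type u} (α : Assign P) (V : Set P) : Set P :=
  {p | (p, true) ∈ α.graph ∨ (p ∉ α.dom ∧ p ∈ V)}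

mutual
/-- `φ.Sat V`: the model `V` satisfies `φ`. -/
def Form.Sat {P : Type u} : Form P → Set P → Prop
  | .var p, V => p ∈ V
  | .neg φ, V => ¬ φ.Sat V
  | .and φ ψ, V => φ.Sat V ∧ ψ.Sat V
  | .box π φ, V => ∀ W, π.Rel V W → φ.Sat W
/-- `π.Rel V W`: some execution of `π` leads from `V` to `W`. -/
def Prog.Rel {P : Type u} : Prog P → Set P → Set P → Prop
  | .assign α, V, W => W = α.update V
  | .seq π₁ π₂, V, W => ∃ U, π₁.Rel V U ∧ π₂.Rel U W
  | .choice π₁ π₂, V, W => π₁.Rel V W ∨ π₂.Rel V W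
  | .star π, V, W => Relation.ReflTransGen (fun U Y => π.Rel U Y) V W
  | .test φ, V, W => W = V ∧ φ.Sat V
end

/-! ## Labelled formulas, branches and tableau rules -/

/-- Labelled formulas: a finite sequence of assignments and a formula. -/
abbrev LForm (P : Type u) := List (Assign P) × Form P

/-- Branches: (finite) sets of labelled formulas. -/
abbrev Branch (P : Type u) := Finset (LForm P)

instance {P : Type u} : DecidableEq (LForm P) := Classical.decEq _

instance {P : Type u} : DecidableEq (Branch P) := Classical.decEq _

/-- The literal `p` (for `v = true`) or `¬p` (for `v = false`). -/
def lit {P : Type u} (p : P) (v : Bool) : Form P :=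
  if v then .var p else .neg (.var p)

/-- The labelled literals `⟨σα, p⟩` with `α p = ⊤` and `⟨σα, ¬p⟩` with `α p = ⊥`. -/
def assignLits {P : Type u} (σ : List (Assign P)) (α : Assign P) : Branch P :=
  α.graph.image fun x => (σ ++ [α], lit x.1 x.2)

open Classical in
/-- The initial branch for `(V, φ₀)`. -/
def initBranch {P : Type u} (V : Set P) (φ₀ : Form P) : Branch P :=
  insert ([], φ₀) (φ₀.vars.image fun p => ([], lit p (decide (p ∈ V))))

/-- The names of the rules. -/
inductive Rule where
  | neg | and | or | boxAssign | diaAssign | boxTest | diaTest | boxSeq | diaSeq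
  | boxChoice | diaChoice | prop1 | prop2 | close

/-- `Gen b ρ l B`: the labelled formula `l ∈ b` is a witness to the rule `ρ` in the branch `b`, and
the application of `ρ` to `b` using `l` as witness generates the set of branches `B`
(to be added to `b`). The rule `close` generates no branch. -/
inductive Gen {P : Type u} (b : Branch P) : Rule → LForm P → Finset (Branch P) → Prop
  | neg {σ φ} : (σ, .neg (.neg φ)) ∈ b →
      Gen b .neg (σ, .neg (.neg φ)) {{(σ, φ)}}
  | and {σ φ ψ} : (σ, .and φ ψ) ∈ b →
      Gen b .and (σ, .and φ ψ) {{(σ, φ), (σ, ψ)}}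
  | or {σ φ ψ} : (σ, .neg (.and φ ψ)) ∈ b →
      Gen b .or (σ, .neg (.and φ ψ)) {{(σ, .neg φ)}, {(σ, .neg ψ)}}
  | boxAssign {σ α φ} : (σ, .box (.assign α) φ) ∈ b →
      Gen b .boxAssign (σ, .box (.assign α) φ) {insert (σ ++ [α], φ) (assignLits σ α)}
  | diaAssign {σ α φ} : (σ, .neg (.box (.assign α) φ)) ∈ b →
      Gen b .diaAssign (σ, .neg (.box (.assign α) φ))
        {insert (σ ++ [α], .neg φ) (assignLits σ α)}
  | boxTest {σ ψ φ} : (σ, .box (.test ψ) φ) ∈ b →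
      Gen b .boxTest (σ, .box (.test ψ) φ) {{(σ, .neg ψ)}, {(σ, φ)}}
  | diaTest {σ ψ φ} : (σ, .neg (.box (.test ψ) φ)) ∈ b →
      Gen b .diaTest (σ, .neg (.box (.test ψ) φ)) {{(σ, ψ), (σ, .neg φ)}}
  | boxSeq {σ π₁ π₂ φ} : (σ, .box (.seq π₁ π₂) φ) ∈ b →
      Gen b .boxSeq (σ, .box (.seq π₁ π₂) φ) {{(σ, .box π₁ (.box π₂ φ))}}
  | diaSeq {σ π₁ π₂ φ} : (σ, .neg (.box (.seq π₁ π₂) φ)) ∈ b →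
      Gen b .diaSeq (σ, .neg (.box (.seq π₁ π₂) φ)) {{(σ, .neg (.box π₁ (.box π₂ φ)))}}
  | boxChoice {σ π₁ π₂ φ} : (σ, .box (.choice π₁ π₂) φ) ∈ b →
      Gen b .boxChoice (σ, .box (.choice π₁ π₂) φ) {{(σ, .box π₁ φ), (σ, .box π₂ φ)}}
  | diaChoice {σ π₁ π₂ φ} : (σ, .neg (.box (.choice π₁ π₂) φ)) ∈ b →
      Gen b .diaChoice (σ, .neg (.box (.choice π₁ π₂) φ))
        {{(σ, .neg (.box π₁ φ))}, {(σ, .neg (.box π₂ φ))}}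
  | prop1 {σ p α ψ} : (σ, .var p) ∈ b → (σ ++ [α], ψ) ∈ b → p ∉ α.dom →
      Gen b .prop1 (σ, .var p) {{(σ ++ [α], .var p)}}
  | prop2 {σ p α ψ} : (σ, .neg (.var p)) ∈ b → (σ ++ [α], ψ) ∈ b → p ∉ α.dom →
      Gen b .prop2 (σ, .neg (.var p)) {{(σ ++ [α], .neg (.var p))}}
  | close {σ φ} : (σ, φ) ∈ b → (σ, .neg φ) ∈ b →
      Gen b .close (σ, φ) ∅

/-- The local rules that generate one branch. -/
def Rule.IsSingle (ρ : Rule) : Prop :=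
  ρ = .neg ∨ ρ = .and ∨ ρ = .diaTest ∨ ρ = .boxSeq ∨ ρ = .diaSeq ∨ ρ = .boxChoice

/-- The local rules that generate two branches or none. -/
def Rule.IsSplit (ρ : Rule) : Prop :=
  ρ = .or ∨ ρ = .boxTest ∨ ρ = .diaChoice ∨ ρ = .close

/-- The rules that create a new label. -/
def Rule.IsSucc (ρ : Rule) : Prop := ρ = .boxAssign ∨ ρ = .diaAssign

/-- The propagation rules. -/
def Rule.IsProp (ρ : Rule) : Prop := ρ = .prop1 ∨ ρ = .prop2

/-- `l` is `⟨σ, [α]ψ⟩` or `⟨σ, ¬[α]ψ⟩` for some `ψ`. -/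
def IsModal {P : Type u} (σ : List (Assign P)) (α : Assign P) (l : LForm P) : Prop :=
  ∃ ψ, l = (σ, .box (.assign α) ψ) ∨ l = (σ, .neg (.box (.assign α) ψ))

/-! ## The algorithm, as a transition system with an explicit call stack -/

/-- Where an activation of `mcTableau` stands, with the values of its current local variables. -/
inductive Ctrl (P : Type u) where
  /-- about to look for a local witness -/
  | test
  /-- after a one-branch rule: waiting for the value of `mcTableau (b ∪ b₁)` -/
  | awaitSingle (b₁ : Branch P)
  /-- in the for-loop: about to treat the remaining elements of `B` -/
  | each (B : Finset (Branch P))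
  /-- in the for-loop: waiting for the value of `mcTableau (b ∪ bᵢ)`; `B` remains to be treated -/
  | awaitSplit (bᵢ : Branch P) (B : Finset (Branch P))
  /-- local saturation is finished: about to look for a successor to create -/
  | outer
  /-- collecting, for the assignment of the witness `l`, the successor `b₁` -/
  | inner (l : LForm P) (b₁ : Branch P)
  /-- propagating literals to the successor `b₁`; `d` holds those already propagated -/
  | prop (l : LForm P) (b₁ : Branch P) (d : Branch P)
  /-- waiting for the value of `mcTableau b₁` -/
  | awaitSucc (l : LForm P) (b₁ : Branch P)

/-- An activation record of `mcTableau`: its own copy of the argument `b`, the set of labelled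
formulas marked non-applicable in it, and the control point. -/
structure Frame (P : Type u) where
  b : Branch P
  marked : Branch P
  ctrl : Ctrl P

/-- `run s`: the activation on top of the stack `s` is executing.
`ret v s`: a call has just returned the value `v` to the top of the stack `s`
(the whole algorithm has halted with output `v` if `s` is empty). -/
inductive Config (P : Type u) where
  | run (stack : List (Frame P))
  | ret (v : Bool) (stack : List (Frame P))

/-- There is an applicable witness to a rule in `R`: a witness which is not in `m`. -/
def Applicable {P : Type u} (R : Rule → Prop) (b m : Branch P) : Prop :=
  ∃ ρ l B, R ρ ∧ Gen b ρ l B ∧ l ∉ m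

/-- One step of the algorithm. The choice of witnesses, and the order in which `B` is traversed in
the for-loop, are left open. -/
inductive Step {P : Type u} : Config P → Config P → Prop
  /-- apply a local rule with one branch, mark the witness, call `mcTableau (b ∪ b₁)` -/
  | single {b m b₁ : Branch P} {s ρ l} : Rule.IsSingle ρ → Gen b ρ l {b₁} → l ∉ m →
      Step (.run (⟨b, m, .test⟩ :: s))
        (.run (⟨b ∪ b₁, insert l m, .test⟩ :: ⟨b, insert l m, .awaitSingle b₁⟩ :: s))
  | singleRet {b m b₁ : Branch P} {s v} :
      Step (.ret v (⟨b, m, .awaitSingle b₁⟩ :: s)) (.ret v s)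
  /-- otherwise choose a local rule with two branches or none, mark the witness -/
  | split {b m : Branch P} {s ρ l B} : ¬ Applicable Rule.IsSingle b m →
      Rule.IsSplit ρ → Gen b ρ l B → l ∉ m →
      Step (.run (⟨b, m, .test⟩ :: s)) (.run (⟨b, insert l m, .each B⟩ :: s))
  /-- for some remaining element of `B`, call `mcTableau (b ∪ bᵢ)` -/
  | eachCall {b m bᵢ : Branch P} {s B} : bᵢ ∈ B →
      Step (.run (⟨b, m, .each B⟩ :: s))
        (.run (⟨b ∪ bᵢ, m, .test⟩ :: ⟨b, m, .awaitSplit bᵢ (B.erase bᵢ)⟩ :: s))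
  /-- as soon as one of these calls returns `true`, return `true` -/
  | eachTrue {b m bᵢ : Branch P} {s B} :
      Step (.ret true (⟨b, m, .awaitSplit bᵢ B⟩ :: s)) (.ret true s)
  | eachFalse {b m bᵢ : Branch P} {s B} :
      Step (.ret false (⟨b, m, .awaitSplit bᵢ B⟩ :: s)) (.run (⟨b, m, .each B⟩ :: s))
  /-- all of them have returned `false` (or there was none): return `false` -/
  | eachEnd {b m : Branch P} {s} :
      Step (.run (⟨b, m, .each ∅⟩ :: s)) (.ret false s)
  /-- end of the local saturation -/
  | local_end {b m : Branch P} {s} : ¬ Applicable Rule.IsSingle b m →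
      ¬ Applicable Rule.IsSplit b m →
      Step (.run (⟨b, m, .test⟩ :: s)) (.run (⟨b, m, .outer⟩ :: s))
  /-- choose a witness `⟨σ, [α]ψ⟩` or `⟨σ, ¬[α]ψ⟩`, start a successor, mark the witness -/
  | outer {b m b₁ : Branch P} {s ρ l} : Rule.IsSucc ρ → Gen b ρ l {b₁} → l ∉ m →
      Step (.run (⟨b, m, .outer⟩ :: s)) (.run (⟨b, insert l m, .inner l b₁⟩ :: s))
  /-- add to the successor what the other witnesses with the same `σ`, `α` generate -/
  | inner {b m b₁ b₂ : Branch P} {s ρ l l₂ σ α} : IsModal σ α l → IsModal σ α l₂ →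
      Rule.IsSucc ρ → Gen b ρ l₂ {b₂} → l₂ ∉ m →
      Step (.run (⟨b, m, .inner l b₁⟩ :: s)) (.run (⟨b, insert l₂ m, .inner l (b₁ ∪ b₂)⟩ :: s))
  /-- no such witness is left -/
  | innerEnd {b m b₁ : Branch P} {s l} :
      (¬ ∃ ρ l₂ B σ α, IsModal σ α l ∧ IsModal σ α l₂ ∧ Rule.IsSucc ρ ∧ Gen b ρ l₂ B ∧ l₂ ∉ m) →
      Step (.run (⟨b, m, .inner l b₁⟩ :: s)) (.run (⟨b, m, .prop l b₁ ∅⟩ :: s))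
  /-- propagate a literal to the successor -/
  | prop {b m b₁ b₂ d : Branch P} {s ρ l l₂} : Rule.IsProp ρ → Gen (b ∪ b₁) ρ l₂ {b₂} →
      l₂ ∉ d →
      Step (.run (⟨b, m, .prop l b₁ d⟩ :: s))
        (.run (⟨b, m, .prop l (b₁ ∪ b₂) (insert l₂ d)⟩ :: s))
  /-- no literal is left to propagate: call `mcTableau b₁` -/
  | propEnd {b m b₁ d : Branch P} {s l} : ¬ Applicable Rule.IsProp (b ∪ b₁) d →
      Step (.run (⟨b, m, .prop l b₁ d⟩ :: s))
        (.run (⟨b₁, ∅, .test⟩ :: ⟨b, m, .awaitSucc l b₁⟩ :: s))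
  /-- the successor is inconsistent: return `false` -/
  | succFalse {b m b₁ : Branch P} {s l} :
      Step (.ret false (⟨b, m, .awaitSucc l b₁⟩ :: s)) (.ret false s)
  /-- otherwise look for another successor -/
  | succTrue {b m b₁ : Branch P} {s l} :
      Step (.ret true (⟨b, m, .awaitSucc l b₁⟩ :: s)) (.run (⟨b, m, .outer⟩ :: s))
  /-- no successor is left to create: return `true` -/
  | outerEnd {b m : Branch P} {s} : ¬ Applicable Rule.IsSucc b m →
      Step (.run (⟨b, m, .outer⟩ :: s)) (.ret true s)

/-- The initial configuration on input `(V, φ₀)`: the call `mcTableau b₀`. -/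
def initConfig {P : Type u} (V : Set P) (φ₀ : Form P) : Config P :=
  .run [⟨initBranch V φ₀, ∅, .test⟩]

/-- `c` occurs in some execution of the algorithm on input `(V, φ₀)`. -/
def Reachable {P : Type u} (V : Set P) (φ₀ : Form P) (c : Config P) : Prop :=
  Relation.ReflTransGen Step (initConfig V φ₀) c

/-! ## Memory

Memory is measured relative to a cost `k l` for storing one labelled formula `l`. Everything that is
alive is counted, and each activation record has an additional unit cost. -/

/-- The cost of a branch. -/
def Branch.mem {P : Type u} (k : LForm P → ℕ) (b : Branch P) : ℕ := ∑ l ∈ b, k l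

/-- The cost of the local variables held at a control point. -/
def Ctrl.mem {P : Type u} (k : LForm P → ℕ) : Ctrl P → ℕ
  | .test => 0
  | .awaitSingle b₁ => Branch.mem k b₁
  | .each B => ∑ b ∈ B, Branch.mem k b
  | .awaitSplit bᵢ B => Branch.mem k bᵢ + ∑ b ∈ B, Branch.mem k b
  | .outer => 0
  | .inner l b₁ => k l + Branch.mem k b₁
  | .prop l b₁ d => k l + Branch.mem k b₁ + Branch.mem k d
  | .awaitSucc l b₁ => k l + Branch.mem k b₁

/-- The cost of an activation record. -/
def Frame.mem {P : Type u} (k : LForm P → ℕ) (f : Frame P) : ℕ :=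
  1 + Branch.mem k f.b + Branch.mem k f.marked + f.ctrl.mem k

/-- The stack of a configuration. -/
def Config.stack {P : Type u} : Config P → List (Frame P)
  | .run s => s
  | .ret _ s => s

/-- The cost of a configuration: the whole call stack. -/
def Config.mem {P : Type u} (k : LForm P → ℕ) (c : Config P) : ℕ :=
  1 + (c.stack.map (Frame.mem k)).sum

/-- Memory counted in labelled formulas. -/
def Config.cells {P : Type u} (c : Config P) : ℕ := c.mem fun _ => 1

/-- Memory counted in symbols, where an occurrence of the variable `p` takes `ν p` symbols: both the
label and the formula of each labelled formula are written out. -/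
def Config.space {P : Type u} (ν : P → ℕ) (c : Config P) : ℕ :=
  c.mem fun l => 1 + (l.1.map (Assign.size ν)).sum + l.2.size ν

end DLPA

end

/-!
The correctness claim behind the algorithm is that a call `mcTableau b` returns `true` if and only
if every `⟨σ, ψ⟩ ∈ b` holds in the model `modelAt V σ` to which `V` is led by `σ`
(`BTrue V b`). The rules are invertible: the witness of a local rule is true if and only if one of
the generated branches is (`Gen.exists_btrue`, `Gen.ltrue`), and `⟨σ, [α]ψ⟩` is true if and only if
`⟨σα, ψ⟩` is. All elements of the argument of a call have the same label `σ`, and they include a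
true literal for every variable of the input. Hence a branch to which no local rule applies is true
as soon as its modal formulas are (`reduces_of_saturated`), and the truth of these is what the
recursive calls for the successors decide. `ConfigInv` turns this into an invariant of the call
stack: each waiting activation records how the truth of its branch depends on the value
of the call it waits for. `ConfigInv.step` shows that the invariant is preserved.

The memory bound comes from three estimates, where `n` is the length of the input. With a fixed
label there are at most `4n` formulas: each node of the syntax tree contributes one
element of the Fischer–Ladner closure, its negation has to be added, and there are two literals for
each variable. The size of a label and the size of a formula that carries it add up to at most
the size of the input, except for literals (`Admissible`); in particular a label has length at
most `n`. Finally, each recursive call either marks a new formula with the same label or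
lengthens the label, so the stack has height `O(n²)`, each record holds `O(n)` labelled
formulas, and each of these has size at most four times that of the input.

Termination follows from the same bound for the height: `callBound` bounds the number of steps of a
call in terms of the possible increase of the level (depth and number of marks), and the total
weight of the stack decreases with each step (`ConfigInv.weight_lt`).
-/

noncomputable section

namespace DLPA

variable {P : Type u}

/-! ### Truth of labelled formulas -/

/-- The model reached from `V` by executing the assignments of the label `σ` in order. -/
def modelAt (V : Set P) (σ : List (Assign P)) : Set P := σ.foldl (fun W α => α.update W) V

@[simp]
lemma modelAt_nil (V : Set P) : modelAt V [] = V := rfl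

@[simp]
lemma modelAt_concat (V : Set P) (σ : List (Assign P)) (α : Assign P) :
    modelAt V (σ ++ [α]) = α.update (modelAt V σ) := by
  simp [modelAt]

/-- Truth of a labelled formula: the formula holds in the model its label leads to. -/
def LTrue (V : Set P) (l : LForm P) : Prop := l.2.Sat (modelAt V l.1)

/-- A branch is true if all its labelled formulas are. -/
def BTrue (V : Set P) (b : Branch P) : Prop := ∀ l ∈ b, LTrue V l

lemma BTrue.mono {V : Set P} {b c : Branch P} (h : BTrue V c) (hbc : b ⊆ c) : BTrue V b :=
  fun l hl => h l (hbc hl)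

lemma BTrue.union {V : Set P} {b c : Branch P} (hb : BTrue V b) (hc : BTrue V c) :
    BTrue V (b ∪ c) := fun l hl => (Finset.mem_union.1 hl).elim (hb l) (hc l)

@[simp]
lemma btrue_singleton {V : Set P} {l : LForm P} : BTrue V {l} ↔ LTrue V l := by
  simp only [BTrue, Finset.mem_singleton, forall_eq]

@[simp]
lemma btrue_insert {V : Set P} {l : LForm P} {b : Branch P} :
    BTrue V (insert l b) ↔ LTrue V l ∧ BTrue V b := by
  simp only [BTrue, Finset.mem_insert, forall_eq_or_imp]

lemma Assign.mem_update_iff_of_mem {α : Assign P} {p : P} {v : Bool} (h : (p, v) ∈ α.graph)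
    (V : Set P) : p ∈ α.update V ↔ v = true := by
  have hd : p ∈ α.dom := ⟨v, h⟩
  simp only [Assign.update, Set.mem_ofPred_eq, hd, not_true_eq_false, false_and, or_false]
  exact ⟨fun h' => α.functional p v true h h', fun h' => h' ▸ h⟩

lemma Assign.mem_update_iff_of_notMem {α : Assign P} {p : P} (h : p ∉ α.dom) (V : Set P) :
    p ∈ α.update V ↔ p ∈ V := by
  have : (p, true) ∉ α.graph := fun h' => h ⟨_, h'⟩
  simp [Assign.update, h, this]

lemma sat_lit {p : P} {v : Bool} {V : Set P} : (lit p v).Sat V ↔ (v = true ↔ p ∈ V) := by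
  cases v <;> simp [lit, Form.Sat]

lemma btrue_assignLits (V : Set P) (σ : List (Assign P)) (α : Assign P) :
    BTrue V (assignLits σ α) := by
  intro l hl
  obtain ⟨⟨p, v⟩, hx, rfl⟩ := Finset.mem_image.1 hl
  simpa [LTrue, sat_lit] using (Assign.mem_update_iff_of_mem hx _).symm

/-! ### The rules and truth -/

/-- The local rules, i.e. those that do not change the label. -/
def Rule.IsLocal (ρ : Rule) : Prop := ρ.IsSingle ∨ ρ.IsSplit

lemma Gen.mem {b : Branch P} {ρ l B} (h : Gen b ρ l B) : l ∈ b := by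
  cases h <;> assumption

lemma Gen.mono {b c : Branch P} {ρ l B} (h : Gen b ρ l B) (hbc : b ⊆ c) : Gen c ρ l B := by
  cases h with
  | prop1 h₁ h₂ h₃ => exact .prop1 (hbc h₁) (hbc h₂) h₃
  | prop2 h₁ h₂ h₃ => exact .prop2 (hbc h₁) (hbc h₂) h₃
  | close h₁ h₂ => exact .close (hbc h₁) (hbc h₂)
  | _ => constructor; exact hbc ‹_›

lemma Gen.exists_btrue {V : Set P} {b : Branch P} {ρ l B} (h : Gen b ρ l B) (hρ : ρ.IsLocal)
    (hb : BTrue V b) : ∃ b' ∈ B, BTrue V b' := by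
  have hl := hb l h.mem
  cases h with
  | close h₁ h₂ => exact absurd (hb _ h₁) (hb _ h₂)
  | boxAssign | diaAssign | prop1 | prop2 =>
    simp [Rule.IsLocal, Rule.IsSingle, Rule.IsSplit] at hρ
  | or | boxTest | diaTest | diaChoice | boxChoice | neg | and | boxSeq | diaSeq =>
    simp [LTrue, Form.Sat, Prog.Rel] at hl ⊢
    grind

lemma Gen.ltrue {V : Set P} {b b' : Branch P} {ρ l B} (h : Gen b ρ l B) (hρ : ρ.IsLocal)
    (hb' : b' ∈ B) (ht : BTrue V b') : LTrue V l := by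
  cases h with
  | close h₁ h₂ => simp at hb'
  | boxAssign | diaAssign | prop1 | prop2 =>
    simp [Rule.IsLocal, Rule.IsSingle, Rule.IsSplit] at hρ
  | or | boxTest | diaTest | diaChoice | boxChoice | neg | and | boxSeq | diaSeq =>
    simp only [Finset.mem_insert, Finset.mem_singleton] at hb'
    try rcases hb' with rfl | rfl
    all_goals
      try subst hb'
      simp [LTrue, Form.Sat, Prog.Rel] at ht ⊢
      grind

mutual
/-- A measure of formulas that decreases along the local rules. Unlike the size it gives weight
`2` to a sequential composition, since `[π₁;π₂]φ` and `[π₁][π₂]φ` have the same size. -/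
def Form.rank : Form P → ℕ
  | .var _ => 0
  | .neg φ => 1 + φ.rank
  | .and φ ψ => 1 + φ.rank + ψ.rank
  | .box π φ => 1 + π.rank + φ.rank
/-- The measure of programs that goes with `Form.rank`. -/
def Prog.rank : Prog P → ℕ
  | .assign _ => 0
  | .seq π₁ π₂ => 2 + π₁.rank + π₂.rank
  | .choice π₁ π₂ => 1 + π₁.rank + π₂.rank
  | .star π => 1 + π.rank
  | .test φ => 1 + φ.rank
end

lemma Gen.rank_lt {b b' : Branch P} {ρ l B} (h : Gen b ρ l B) (hρ : ρ.IsLocal)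
    (hb' : b' ∈ B) : ∀ l' ∈ b', l'.2.rank < l.2.rank := by
  cases h with
  | close h₁ h₂ => simp at hb'
  | boxAssign | diaAssign | prop1 | prop2 =>
    simp [Rule.IsLocal, Rule.IsSingle, Rule.IsSplit] at hρ
  | or | boxTest | diaTest | diaChoice | boxChoice | neg | and | boxSeq | diaSeq =>
    simp only [Finset.mem_insert, Finset.mem_singleton] at hb'
    try rcases hb' with rfl | rfl
    all_goals
      try subst hb'
      simp [Form.rank, Prog.rank]
      try omega

/-! ### The closure of a formula -/

open Classical in
mutual
/-- The Fischer–Ladner closure of a star-free formula, without negations. Starred programs are not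
unfolded. -/
def Form.cl : Form P → Finset (Form P)
  | .var p => {.var p}
  | .neg φ => insert (.neg φ) φ.cl
  | .and φ ψ => insert (.and φ ψ) (φ.cl ∪ ψ.cl)
  | .box π φ => π.cl φ ∪ φ.cl
/-- The boxed formulas to which the local rules lead from `[π]φ` before `φ` is reached, and the
closures of the tests in `π`. Each node of `π` contributes at most one formula. -/
def Prog.cl : Prog P → Form P → Finset (Form P)
  | .assign α, φ => {.box (.assign α) φ}
  | .seq π₁ π₂, φ => insert (.box (.seq π₁ π₂) φ) (π₁.cl (.box π₂ φ) ∪ π₂.cl φ)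
  | .choice π₁ π₂, φ => insert (.box (.choice π₁ π₂) φ) (π₁.cl φ ∪ π₂.cl φ)
  | .star π, φ => {.box (.star π) φ}
  | .test ψ, φ => insert (.box (.test ψ) φ) ψ.cl
end

lemma Prog.box_mem_cl (π : Prog P) (φ : Form P) : .box π φ ∈ π.cl φ := by
  cases π <;> simp [Prog.cl]

lemma Form.mem_cl_self (φ : Form P) : φ ∈ φ.cl := by
  cases φ <;> simp [Form.cl, Prog.box_mem_cl]

open Classical in
mutual
lemma Form.cl_subset_of_mem : ∀ {φ χ : Form P}, χ ∈ φ.cl → χ.cl ⊆ φ.cl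
  | .var p, χ, h => by
    rw [Form.cl, Finset.mem_singleton] at h
    rw [h]
  | .neg φ, χ, h => by
    rw [Form.cl, Finset.mem_insert] at h
    rcases h with rfl | h
    · exact subset_rfl
    · exact (Form.cl_subset_of_mem h).trans (by rw [Form.cl]; exact Finset.subset_insert _ _)
  | .and φ ψ, χ, h => by
    rw [Form.cl, Finset.mem_insert, Finset.mem_union] at h
    rcases h with rfl | h | h
    · exact subset_rfl
    · exact (Form.cl_subset_of_mem h).trans (by rw [Form.cl]; grind)
    · exact (Form.cl_subset_of_mem h).trans (by rw [Form.cl]; grind)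
  | .box π φ, χ, h => by
    rw [Form.cl, Finset.mem_union] at h
    rcases h with h | h
    · exact Prog.cl_subset_of_mem h
    · exact (Form.cl_subset_of_mem h).trans (by rw [Form.cl]; exact Finset.subset_union_right)
lemma Prog.cl_subset_of_mem : ∀ {π : Prog P} {φ χ : Form P}, χ ∈ π.cl φ →
    χ.cl ⊆ (Form.box π φ).cl
  | .assign α, φ, χ, h => by
    rw [Prog.cl, Finset.mem_singleton] at h
    rw [h]
  | .seq π₁ π₂, φ, χ, h => by
    rw [Prog.cl, Finset.mem_insert, Finset.mem_union] at h
    rcases h with rfl | h | h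
    · exact subset_rfl
    · exact (Prog.cl_subset_of_mem h).trans (by simp only [Form.cl, Prog.cl]; grind)
    · exact (Prog.cl_subset_of_mem h).trans (by simp only [Form.cl, Prog.cl]; grind)
  | .choice π₁ π₂, φ, χ, h => by
    rw [Prog.cl, Finset.mem_insert, Finset.mem_union] at h
    rcases h with rfl | h | h
    · exact subset_rfl
    · exact (Prog.cl_subset_of_mem h).trans (by simp only [Form.cl, Prog.cl]; grind)
    · exact (Prog.cl_subset_of_mem h).trans (by simp only [Form.cl, Prog.cl]; grind)
  | .star π, φ, χ, h => by
    rw [Prog.cl, Finset.mem_singleton] at h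
    rw [h]
  | .test ψ, φ, χ, h => by
    rw [Prog.cl, Finset.mem_insert] at h
    rcases h with rfl | h
    · exact subset_rfl
    · exact (Form.cl_subset_of_mem h).trans (by simp only [Form.cl, Prog.cl]; grind)
end

lemma Assign.size_one_pos (α : Assign P) : 0 < α.size fun _ => 1 := by
  simpa [Assign.size] using α.nonempty

open Classical in
mutual
lemma Form.card_cl_le : ∀ φ : Form P, φ.cl.card ≤ φ.len
  | .var p => by simp [Form.cl, Form.len, Form.size]
  | .neg φ => by
    have h := Form.card_cl_le φ
    simp only [Form.cl, Form.len, Form.size] at h ⊢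
    grind [Finset.card_insert_le]
  | .and φ ψ => by
    have h := Form.card_cl_le φ
    have h' := Form.card_cl_le ψ
    simp only [Form.cl, Form.len, Form.size] at h h' ⊢
    grind [Finset.card_insert_le, Finset.card_union_le]
  | .box π φ => by
    have h := Prog.card_cl_le π φ
    have h' := Form.card_cl_le φ
    simp only [Form.cl, Form.len, Form.size] at h h' ⊢
    grind [Finset.card_union_le]
lemma Prog.card_cl_le : ∀ (π : Prog P) (φ : Form P), (π.cl φ).card ≤ π.size fun _ => 1
  | .assign α, φ => by
    have := α.size_one_pos
    simp only [Prog.cl, Prog.size, Finset.card_singleton]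
    omega
  | .seq π₁ π₂, φ => by
    have h := Prog.card_cl_le π₁ (.box π₂ φ)
    have h' := Prog.card_cl_le π₂ φ
    simp only [Prog.cl, Prog.size]
    grind [Finset.card_insert_le, Finset.card_union_le]
  | .choice π₁ π₂, φ => by
    have h := Prog.card_cl_le π₁ φ
    have h' := Prog.card_cl_le π₂ φ
    simp only [Prog.cl, Prog.size]
    grind [Finset.card_insert_le, Finset.card_union_le]
  | .star π, φ => by simp [Prog.cl, Prog.size]
  | .test ψ, φ => by
    have h := Form.card_cl_le ψ
    simp only [Prog.cl, Prog.size, Form.len] at h ⊢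
    grind [Finset.card_insert_le]
end

open Classical in
mutual
lemma Form.card_vars_le : ∀ φ : Form P, φ.vars.card ≤ φ.len
  | .var p => by simp [Form.vars, Form.len, Form.size]
  | .neg φ => by
    have h := Form.card_vars_le φ
    simp only [Form.vars, Form.len, Form.size] at h ⊢
    omega
  | .and φ ψ => by
    have h := Form.card_vars_le φ
    have h' := Form.card_vars_le ψ
    simp only [Form.vars, Form.len, Form.size] at h h' ⊢
    grind [Finset.card_union_le]
  | .box π φ => by
    have h := Prog.card_vars_le π
    have h' := Form.card_vars_le φ
    simp only [Form.vars, Form.len, Form.size] at h h' ⊢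
    grind [Finset.card_union_le]
lemma Prog.card_vars_le : ∀ π : Prog P, π.vars.card ≤ π.size fun _ => 1
  | .assign α => by
    simp only [Prog.vars, Prog.size, Assign.size, Finset.sum_const, smul_eq_mul, mul_one]
    exact Finset.card_image_le
  | .seq π₁ π₂ => by
    have h := Prog.card_vars_le π₁
    have h' := Prog.card_vars_le π₂
    simp only [Prog.vars, Prog.size]
    grind [Finset.card_union_le]
  | .choice π₁ π₂ => by
    have h := Prog.card_vars_le π₁
    have h' := Prog.card_vars_le π₂
    simp only [Prog.vars, Prog.size]
    grind [Finset.card_union_le]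
  | .star π => by
    have h := Prog.card_vars_le π
    simp only [Prog.vars, Prog.size]
    omega
  | .test ψ => by
    have h := Form.card_vars_le ψ
    simp only [Prog.vars, Prog.size, Form.len] at h ⊢
    omega
end

open Classical in
mutual
lemma Form.le_size_of_mem_vars (ν : P → ℕ) {p : P} : ∀ φ : Form P, p ∈ φ.vars → ν p ≤ φ.size ν
  | .var q, h => by simp_all [Form.vars, Form.size]
  | .neg φ, h => by
    have h' := Form.le_size_of_mem_vars ν (p := p) φ
    simp only [Form.vars, Form.size] at h ⊢
    grind
  | .and φ ψ, h => by
    have h₁ := Form.le_size_of_mem_vars ν (p := p) φ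
    have h₂ := Form.le_size_of_mem_vars ν (p := p) ψ
    simp only [Form.vars, Form.size] at h ⊢
    grind
  | .box π φ, h => by
    have h₁ := Prog.le_size_of_mem_vars ν (p := p) π
    have h₂ := Form.le_size_of_mem_vars ν (p := p) φ
    simp only [Form.vars, Form.size] at h ⊢
    grind
lemma Prog.le_size_of_mem_vars (ν : P → ℕ) {p : P} : ∀ π : Prog P, p ∈ π.vars → ν p ≤ π.size ν
  | .assign α, h => by
    simp only [Prog.vars, Prog.size, Assign.size, Finset.mem_image] at h ⊢
    obtain ⟨x, hx, rfl⟩ := h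
    exact Finset.single_le_sum (f := fun x : P × Bool => ν x.1) (fun _ _ => Nat.zero_le _) hx
  | .seq π₁ π₂, h => by
    have h₁ := Prog.le_size_of_mem_vars ν (p := p) π₁
    have h₂ := Prog.le_size_of_mem_vars ν (p := p) π₂
    simp only [Prog.vars, Prog.size] at h ⊢
    grind
  | .choice π₁ π₂, h => by
    have h₁ := Prog.le_size_of_mem_vars ν (p := p) π₁
    have h₂ := Prog.le_size_of_mem_vars ν (p := p) π₂
    simp only [Prog.vars, Prog.size] at h ⊢
    grind
  | .star π, h => by
    have h₁ := Prog.le_size_of_mem_vars ν (p := p) π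
    simp only [Prog.vars, Prog.size] at h ⊢
    grind
  | .test ψ, h => by
    have h₁ := Form.le_size_of_mem_vars ν (p := p) ψ
    simp only [Prog.vars, Prog.size] at h ⊢
    grind
end

lemma Form.size_pos {ν : P → ℕ} (hν : ∀ p, 1 ≤ ν p) : ∀ φ : Form P, 1 ≤ φ.size ν
  | .var p => hν p
  | .neg φ => by rw [Form.size]; omega
  | .and φ ψ => by rw [Form.size]; omega
  | .box π φ => by rw [Form.size]; omega

open Classical in
/-- The formulas that can occur in a branch when the algorithm runs on `φ₀`: the closure of `φ₀`,
the negations of its elements and the literals over the variables of `φ₀`. The literals have to be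
listed since a variable may occur in `φ₀` in assignments only. -/
def allowed (φ₀ : Form P) : Finset (Form P) :=
  φ₀.cl ∪ φ₀.cl.image .neg ∪ (φ₀.vars ×ˢ Finset.univ).image fun x : P × Bool => lit x.1 x.2

open Classical in
lemma mem_allowed {φ₀ ψ : Form P} : ψ ∈ allowed φ₀ ↔
    ψ ∈ φ₀.cl ∨ (∃ χ ∈ φ₀.cl, ψ = .neg χ) ∨ ∃ p ∈ φ₀.vars, ∃ v, ψ = lit p v := by
  simp only [allowed, Finset.mem_union, Finset.mem_image, Finset.mem_product, Finset.mem_univ,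
    and_true, Prod.exists, or_assoc]
  grind

open Classical in
lemma card_allowed_le (φ₀ : Form P) : (allowed φ₀).card ≤ 4 * φ₀.len := by
  have h₁ := φ₀.card_cl_le
  have h₂ := φ₀.card_vars_le
  have h₃ : (φ₀.cl.image Form.neg).card ≤ φ₀.cl.card := Finset.card_image_le
  have h₄ : ((φ₀.vars ×ˢ Finset.univ).image fun x : P × Bool => lit x.1 x.2).card
      ≤ φ₀.vars.card * 2 := by
    refine Finset.card_image_le.trans ?_
    simp
  unfold allowed
  grind [Finset.card_union_le]

lemma cl_of_neg_mem_allowed {φ₀ χ : Form P} (h : .neg χ ∈ allowed φ₀) (hχ : ∀ p, χ ≠ .var p) :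
    χ ∈ φ₀.cl := by
  rcases mem_allowed.1 h with h | ⟨_, h, h'⟩ | ⟨p, -, v, h⟩
  · exact Form.cl_subset_of_mem h (by simp [Form.cl, Form.mem_cl_self])
  · cases h'
    exact h
  · cases v
    · simp [lit] at h
      exact absurd h (hχ p)
    · simp [lit] at h

lemma cl_of_mem_allowed {φ₀ χ : Form P} (h : χ ∈ allowed φ₀) (hχ : ∀ p, χ ≠ .var p)
    (hχ' : ∀ ψ, χ ≠ .neg ψ) : χ ∈ φ₀.cl := by
  rcases mem_allowed.1 h with h | ⟨_, h, h'⟩ | ⟨p, -, v, h⟩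
  · exact h
  · exact absurd h' (hχ' _)
  · cases v
    · exact absurd h (hχ' _)
    · exact absurd h (hχ _)

lemma neg_mem_allowed {φ₀ χ : Form P} (h : χ ∈ φ₀.cl) : .neg χ ∈ allowed φ₀ :=
  mem_allowed.2 (.inr (.inl ⟨χ, h, rfl⟩))

lemma mem_allowed_of_cl {φ₀ χ : Form P} (h : χ ∈ φ₀.cl) : χ ∈ allowed φ₀ :=
  mem_allowed.2 (.inl h)

lemma and_left_mem_cl {φ₀ φ ψ : Form P} (h : .and φ ψ ∈ φ₀.cl) : φ ∈ φ₀.cl :=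
  Form.cl_subset_of_mem h (by simp [Form.cl, Form.mem_cl_self])

lemma and_right_mem_cl {φ₀ φ ψ : Form P} (h : .and φ ψ ∈ φ₀.cl) : ψ ∈ φ₀.cl :=
  Form.cl_subset_of_mem h (by simp [Form.cl, Form.mem_cl_self])

lemma box_mem_cl {φ₀ φ : Form P} {π : Prog P} (h : .box π φ ∈ φ₀.cl) : φ ∈ φ₀.cl :=
  Form.cl_subset_of_mem h (by simp [Form.cl, Form.mem_cl_self])

lemma test_mem_cl {φ₀ φ ψ : Form P} (h : .box (.test ψ) φ ∈ φ₀.cl) : ψ ∈ φ₀.cl :=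
  Form.cl_subset_of_mem h (by simp [Form.cl, Prog.cl, Form.mem_cl_self])

lemma seq_mem_cl {φ₀ φ : Form P} {π₁ π₂ : Prog P} (h : .box (.seq π₁ π₂) φ ∈ φ₀.cl) :
    .box π₁ (.box π₂ φ) ∈ φ₀.cl :=
  Form.cl_subset_of_mem h (by simp [Form.cl, Prog.cl, Prog.box_mem_cl])

lemma choice_left_mem_cl {φ₀ φ : Form P} {π₁ π₂ : Prog P}
    (h : .box (.choice π₁ π₂) φ ∈ φ₀.cl) : .box π₁ φ ∈ φ₀.cl :=
  Form.cl_subset_of_mem h (by simp [Form.cl, Prog.cl, Prog.box_mem_cl])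

lemma choice_right_mem_cl {φ₀ φ : Form P} {π₁ π₂ : Prog P}
    (h : .box (.choice π₁ π₂) φ ∈ φ₀.cl) : .box π₂ φ ∈ φ₀.cl :=
  Form.cl_subset_of_mem h (by simp [Form.cl, Prog.cl, Prog.box_mem_cl])

/-! ### Admissible labelled formulas -/

/-- The size of a label. -/
def labelSize (ν : P → ℕ) (σ : List (Assign P)) : ℕ := (σ.map (Assign.size ν)).sum

@[simp]
lemma labelSize_concat (ν : P → ℕ) (σ : List (Assign P)) (α : Assign P) :
    labelSize ν (σ ++ [α]) = labelSize ν σ + α.size ν := by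
  simp [labelSize]

lemma length_le_labelSize (σ : List (Assign P)) : σ.length ≤ labelSize (fun _ => 1) σ := by
  induction σ with
  | nil => simp
  | cons α σ ih =>
    have := α.size_one_pos
    simp only [labelSize, List.map_cons, List.sum_cons, List.length_cons] at ih ⊢
    omega

/-- The labelled formulas that can occur when the algorithm runs on `φ₀`. The size of a formula and
the size of its label are bounded together, except for literals: these are also produced by
assignments and by propagation, without a decrease in size. -/
structure Admissible (φ₀ : Form P) (l : LForm P) : Prop where
  starFree : l.2.StarFree
  vars_subset : l.2.vars ⊆ φ₀.vars
  mem_allowed : l.2 ∈ allowed φ₀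
  labelSize_le : ∀ ν, labelSize ν l.1 ≤ φ₀.size ν
  size_le : (∃ p v, l.2 = lit p v) ∨ ∀ ν, labelSize ν l.1 + l.2.size ν ≤ φ₀.size ν

lemma admissible_self {φ₀ : Form P} (h : φ₀.StarFree) : Admissible φ₀ ([], φ₀) where
  starFree := h
  vars_subset := subset_rfl
  mem_allowed := mem_allowed_of_cl φ₀.mem_cl_self
  labelSize_le := by simp [labelSize]
  size_le := .inr (by simp [labelSize])

lemma admissible_lit {φ₀ : Form P} {σ : List (Assign P)} {p : P} (hp : p ∈ φ₀.vars) (v : Bool)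
    (hσ : ∀ ν, labelSize ν σ ≤ φ₀.size ν) : Admissible φ₀ (σ, lit p v) where
  starFree := by cases v <;> simp [lit, Form.StarFree]
  vars_subset := by cases v <;> simpa [lit, Form.vars] using hp
  mem_allowed := DLPA.mem_allowed.2 (.inr (.inr ⟨p, hp, v, rfl⟩))
  labelSize_le := hσ
  size_le := .inl ⟨p, v, rfl⟩

/-- Decreasing the size of formula and label together preserves admissibility. -/
lemma Admissible.of_size_le {φ₀ : Form P} {l l' : LForm P} (h : Admissible φ₀ l)
    (hl : ∀ p v, l.2 ≠ lit p v) (hsf : l'.2.StarFree) (hvars : l'.2.vars ⊆ l.2.vars)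
    (hmem : l'.2 ∈ allowed φ₀)
    (hsize : ∀ ν, labelSize ν l'.1 + l'.2.size ν ≤ labelSize ν l.1 + l.2.size ν) :
    Admissible φ₀ l' := by
  have hs : ∀ ν, labelSize ν l'.1 + l'.2.size ν ≤ φ₀.size ν := by
    intro ν
    rcases h.size_le with ⟨p, v, h'⟩ | h'
    · exact absurd h' (hl p v)
    · exact (hsize ν).trans (h' ν)
  exact ⟨hsf, hvars.trans h.vars_subset, hmem, fun ν => by have := hs ν; omega, .inr hs⟩

lemma neg_neg_ne_lit (φ : Form P) (p : P) (v : Bool) : Form.neg (.neg φ) ≠ lit p v := by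
  cases v <;> simp [lit]

lemma and_ne_lit (φ ψ : Form P) (p : P) (v : Bool) : Form.and φ ψ ≠ lit p v := by
  cases v <;> simp [lit]

lemma box_ne_lit (π : Prog P) (φ : Form P) (p : P) (v : Bool) : Form.box π φ ≠ lit p v := by
  cases v <;> simp [lit]

lemma neg_and_ne_lit (φ ψ : Form P) (p : P) (v : Bool) : Form.neg (.and φ ψ) ≠ lit p v := by
  cases v <;> simp [lit]

lemma neg_box_ne_lit (π : Prog P) (φ : Form P) (p : P) (v : Bool) :
    Form.neg (.box π φ) ≠ lit p v := by
  cases v <;> simp [lit]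

lemma Gen.label_eq {b b' : Branch P} {ρ l B} (h : Gen b ρ l B) (hρ : ρ.IsLocal)
    (hb' : b' ∈ B) : ∀ l' ∈ b', l'.1 = l.1 := by
  cases h with
  | close h₁ h₂ => simp at hb'
  | boxAssign | diaAssign | prop1 | prop2 =>
    simp [Rule.IsLocal, Rule.IsSingle, Rule.IsSplit] at hρ
  | or | boxTest | diaTest | diaChoice | boxChoice | neg | and | boxSeq | diaSeq =>
    simp only [Finset.mem_insert, Finset.mem_singleton] at hb'
    grind

lemma Gen.card_le {b : Branch P} {ρ l B} (h : Gen b ρ l B) : B.card ≤ 2 := by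
  cases h <;> first | exact Finset.card_le_two | simp

open Classical in
lemma Gen.admissible {φ₀ : Form P} {b b' : Branch P} {ρ l B} (h : Gen b ρ l B) (hρ : ρ.IsLocal)
    (hb' : b' ∈ B) (hl : Admissible φ₀ l) : ∀ l' ∈ b', Admissible φ₀ l' := by
  have hsf := hl.starFree
  have hm := hl.mem_allowed
  have neg_and {φ ψ : Form P} (h : .neg (.and φ ψ) ∈ allowed φ₀) : .and φ ψ ∈ φ₀.cl :=
    cl_of_neg_mem_allowed h (by simp)
  have neg_box {π} {φ : Form P} (h : .neg (.box π φ) ∈ allowed φ₀) : .box π φ ∈ φ₀.cl :=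
    cl_of_neg_mem_allowed h (by simp)
  have box {π} {φ : Form P} (h : .box π φ ∈ allowed φ₀) : .box π φ ∈ φ₀.cl :=
    cl_of_mem_allowed h (by simp) (by simp)
  intro l' hl'
  cases h with
  | close h₁ h₂ => simp at hb'
  | boxAssign | diaAssign | prop1 | prop2 =>
    simp [Rule.IsLocal, Rule.IsSingle, Rule.IsSplit] at hρ
  | neg =>
    have hφ := cl_of_neg_mem_allowed hm (by simp)
    simp only [Finset.mem_singleton] at hb'
    subst hb'
    rw [Finset.mem_singleton] at hl'
    subst hl'
    refine hl.of_size_le (neg_neg_ne_lit _) hsf (by simp [Form.vars])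
      (mem_allowed_of_cl (Form.cl_subset_of_mem hφ ?_)) fun ν => by simp [Form.size]; omega
    simp [Form.cl, Form.mem_cl_self]
  | and =>
    have hφ := cl_of_mem_allowed hm (by simp) (by simp)
    simp only [Finset.mem_singleton] at hb'
    subst hb'
    simp only [Finset.mem_insert, Finset.mem_singleton] at hl'
    rcases hl' with rfl | rfl
    · exact hl.of_size_le (and_ne_lit _ _) hsf.1 (by simp [Form.vars])
        (mem_allowed_of_cl (and_left_mem_cl hφ)) fun ν => by simp [Form.size]; omega
    · exact hl.of_size_le (and_ne_lit _ _) hsf.2 (by simp [Form.vars])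
        (mem_allowed_of_cl (and_right_mem_cl hφ)) fun ν => by simp [Form.size]
  | or =>
    simp only [Finset.mem_insert, Finset.mem_singleton] at hb'
    rcases hb' with rfl | rfl <;> rw [Finset.mem_singleton] at hl' <;> subst hl'
    · exact hl.of_size_le (neg_and_ne_lit _ _) hsf.1 (by simp [Form.vars])
        (neg_mem_allowed (and_left_mem_cl (neg_and hm))) fun ν => by simp [Form.size]; omega
    · exact hl.of_size_le (neg_and_ne_lit _ _) hsf.2 (by simp [Form.vars])
        (neg_mem_allowed (and_right_mem_cl (neg_and hm))) fun ν => by simp [Form.size]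
  | boxTest =>
    simp only [Finset.mem_insert, Finset.mem_singleton] at hb'
    rcases hb' with rfl | rfl <;> rw [Finset.mem_singleton] at hl' <;> subst hl'
    · exact hl.of_size_le (box_ne_lit _ _) hsf.1 (by simp [Form.vars, Prog.vars])
        (neg_mem_allowed (test_mem_cl (box hm))) fun ν => by simp [Form.size, Prog.size]; omega
    · exact hl.of_size_le (box_ne_lit _ _) hsf.2 (by simp [Form.vars])
        (mem_allowed_of_cl (box_mem_cl (box hm))) fun ν => by simp [Form.size]
  | diaTest =>
    simp only [Finset.mem_singleton] at hb'
    subst hb'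
    simp only [Finset.mem_insert, Finset.mem_singleton] at hl'
    rcases hl' with rfl | rfl
    · exact hl.of_size_le (neg_box_ne_lit _ _) hsf.1 (by simp [Form.vars, Prog.vars])
        (mem_allowed_of_cl (test_mem_cl (neg_box hm))) fun ν => by
          simp [Form.size, Prog.size]; omega
    · exact hl.of_size_le (neg_box_ne_lit _ _) hsf.2 (by simp [Form.vars])
        (neg_mem_allowed (box_mem_cl (neg_box hm))) fun ν => by simp [Form.size]
  | boxSeq =>
    simp only [Finset.mem_singleton] at hb'
    subst hb'
    rw [Finset.mem_singleton] at hl'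
    subst hl'
    exact hl.of_size_le (box_ne_lit _ _) ⟨hsf.1.1, hsf.1.2, hsf.2⟩
      (by simp [Form.vars, Prog.vars]) (mem_allowed_of_cl (seq_mem_cl (box hm)))
      fun ν => by simp [Form.size, Prog.size]; omega
  | diaSeq =>
    simp only [Finset.mem_singleton] at hb'
    subst hb'
    rw [Finset.mem_singleton] at hl'
    subst hl'
    exact hl.of_size_le (neg_box_ne_lit _ _) ⟨hsf.1.1, hsf.1.2, hsf.2⟩
      (by simp [Form.vars, Prog.vars]) (neg_mem_allowed (seq_mem_cl (neg_box hm)))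
      fun ν => by simp [Form.size, Prog.size]; omega
  | boxChoice =>
    simp only [Finset.mem_singleton] at hb'
    subst hb'
    simp only [Finset.mem_insert, Finset.mem_singleton] at hl'
    rcases hl' with rfl | rfl
    · exact hl.of_size_le (box_ne_lit _ _) ⟨hsf.1.1, hsf.2⟩
        (by simp only [Form.vars, Prog.vars]; grind)
        (mem_allowed_of_cl (choice_left_mem_cl (box hm))) fun ν => by
          simp [Form.size, Prog.size]; omega
    · exact hl.of_size_le (box_ne_lit _ _) ⟨hsf.1.2, hsf.2⟩
        (by simp only [Form.vars, Prog.vars]; grind)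
        (mem_allowed_of_cl (choice_right_mem_cl (box hm))) fun ν => by simp [Form.size, Prog.size]
  | diaChoice =>
    simp only [Finset.mem_insert, Finset.mem_singleton] at hb'
    rcases hb' with rfl | rfl <;> rw [Finset.mem_singleton] at hl' <;> subst hl'
    · exact hl.of_size_le (neg_box_ne_lit _ _) ⟨hsf.1.1, hsf.2⟩
        (by simp only [Form.vars, Prog.vars]; grind)
        (neg_mem_allowed (choice_left_mem_cl (neg_box hm))) fun ν => by
          simp [Form.size, Prog.size]; omega
    · exact hl.of_size_le (neg_box_ne_lit _ _) ⟨hsf.1.2, hsf.2⟩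
        (by simp only [Form.vars, Prog.vars]; grind)
        (neg_mem_allowed (choice_right_mem_cl (neg_box hm))) fun ν => by simp [Form.size, Prog.size]

/-! ### Successors and propagation -/

open Classical in
lemma Gen.succ {b : Branch P} {ρ l B} (h : Gen b ρ l B) (hρ : ρ.IsSucc) :
    ∃ σ α ψ, IsModal σ α l ∧ B = {insert (σ ++ [α], ψ) (assignLits σ α)} ∧
      (∀ V, LTrue V l ↔ LTrue V (σ ++ [α], ψ)) ∧
      ∀ φ₀, Admissible φ₀ l → ∀ l' ∈ insert (σ ++ [α], ψ) (assignLits σ α), Admissible φ₀ l' := by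
  have lits {φ₀ : Form P} {σ : List (Assign P)} {α : Assign P} (hα : (Prog.assign α).vars ⊆ φ₀.vars)
      (hσ : ∀ ν, labelSize ν (σ ++ [α]) ≤ φ₀.size ν) :
      ∀ l' ∈ assignLits σ α, Admissible φ₀ l' := by
    intro l' hl'
    obtain ⟨x, hx, rfl⟩ := Finset.mem_image.1 hl'
    exact admissible_lit (hα (by rw [Prog.vars]; exact Finset.mem_image_of_mem _ hx)) _ hσ
  cases h with
  | @boxAssign σ α φ h =>
    refine ⟨σ, α, φ, ⟨φ, .inl rfl⟩, rfl, fun V => ?_, fun φ₀ hl => ?_⟩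
    · simp [LTrue, Form.Sat, Prog.Rel]
    · have hφ : Admissible φ₀ (σ ++ [α], φ) := by
        refine hl.of_size_le (box_ne_lit _ _) hl.starFree.2 (by simp [Form.vars])
          (mem_allowed_of_cl (box_mem_cl (cl_of_mem_allowed hl.mem_allowed ?_ ?_))) fun ν => ?_
        · simp
        · simp
        · simp [Form.size, Prog.size]; omega
      have hv := hl.vars_subset
      simp only [Form.vars] at hv
      refine fun l' hl' => (Finset.mem_insert.1 hl').elim (fun h => h ▸ hφ)
        (lits (Finset.union_subset_left hv) hφ.labelSize_le _)
  | @diaAssign σ α φ h =>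
    refine ⟨σ, α, .neg φ, ⟨φ, .inr rfl⟩, rfl, fun V => ?_, fun φ₀ hl => ?_⟩
    · simp [LTrue, Form.Sat, Prog.Rel]
    · have hφ : Admissible φ₀ (σ ++ [α], .neg φ) := by
        refine hl.of_size_le (neg_box_ne_lit _ _) hl.starFree.2 (by simp [Form.vars])
          (neg_mem_allowed (box_mem_cl (cl_of_neg_mem_allowed hl.mem_allowed ?_))) fun ν => ?_
        · simp
        · simp [Form.size, Prog.size]; omega
      have hv := hl.vars_subset
      simp only [Form.vars] at hv
      refine fun l' hl' => (Finset.mem_insert.1 hl').elim (fun h => h ▸ hφ)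
        (lits (Finset.union_subset_left hv) hφ.labelSize_le _)
  | neg | and | or | boxTest | diaTest | boxSeq | diaSeq | boxChoice | diaChoice | prop1 | prop2
  | close => simp [Rule.IsSucc] at hρ

lemma IsModal.label_eq {σ : List (Assign P)} {α : Assign P} {l : LForm P} (h : IsModal σ α l) :
    l.1 = σ := by
  obtain ⟨ψ, rfl | rfl⟩ := h <;> rfl

lemma IsModal.unique {σ τ : List (Assign P)} {α β : Assign P} {l : LForm P} (h : IsModal σ α l)
    (h' : IsModal τ β l) : σ = τ ∧ α = β := by
  obtain ⟨ψ, rfl | rfl⟩ := h <;> obtain ⟨χ, h | h⟩ := h' <;> simp_all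

lemma IsModal.gen {σ : List (Assign P)} {α : Assign P} {l : LForm P} {b : Branch P}
    (h : IsModal σ α l) (hl : l ∈ b) : ∃ ρ B, Rule.IsSucc ρ ∧ Gen b ρ l B := by
  obtain ⟨ψ, rfl | rfl⟩ := h
  · exact ⟨_, _, .inl rfl, .boxAssign hl⟩
  · exact ⟨_, _, .inr rfl, .diaAssign hl⟩

lemma Gen.prop {b : Branch P} {ρ l B} (h : Gen b ρ l B) (hρ : ρ.IsProp) :
    ∃ σ p v α ψ, l = (σ, lit p v) ∧ (σ ++ [α], ψ) ∈ b ∧ p ∉ α.dom ∧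
      B = {{(σ ++ [α], lit p v)}} := by
  cases h with
  | @prop1 σ p α ψ h₁ h₂ h₃ => exact ⟨σ, p, true, α, ψ, rfl, h₂, h₃, rfl⟩
  | @prop2 σ p α ψ h₁ h₂ h₃ => exact ⟨σ, p, false, α, ψ, rfl, h₂, h₃, rfl⟩
  | neg | and | or | boxTest | diaTest | boxSeq | diaSeq | boxChoice | diaChoice | boxAssign
  | diaAssign | close => simp [Rule.IsProp] at hρ

lemma gen_prop {b : Branch P} {σ : List (Assign P)} {p : P} {v : Bool} {α : Assign P} {ψ : Form P}
    (h₁ : (σ, lit p v) ∈ b) (h₂ : (σ ++ [α], ψ) ∈ b) (h₃ : p ∉ α.dom) :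
    ∃ ρ B, Rule.IsProp ρ ∧ Gen b ρ (σ, lit p v) B := by
  cases v
  · exact ⟨_, _, .inr rfl, .prop2 h₁ h₂ h₃⟩
  · exact ⟨_, _, .inl rfl, .prop1 h₁ h₂ h₃⟩

/-! ### Branches of the algorithm -/

/-- All elements of `b` are admissible and have label `σ`. -/
def Labelled (φ₀ : Form P) (σ : List (Assign P)) (b : Branch P) : Prop :=
  ∀ l ∈ b, l.1 = σ ∧ Admissible φ₀ l

lemma Labelled.union {φ₀ : Form P} {σ : List (Assign P)} {b c : Branch P} (hb : Labelled φ₀ σ b)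
    (hc : Labelled φ₀ σ c) : Labelled φ₀ σ (b ∪ c) :=
  fun l hl => (Finset.mem_union.1 hl).elim (hb l) (hc l)

lemma Labelled.card_le {φ₀ : Form P} {σ : List (Assign P)} {b : Branch P}
    (h : Labelled φ₀ σ b) : b.card ≤ (allowed φ₀).card := by
  refine Finset.card_le_card_of_injOn Prod.snd (fun l hl => (h l hl).2.mem_allowed) ?_
  intro l hl l' hl' he
  exact Prod.ext ((h l hl).1.trans (h l' hl').1.symm) he

lemma Labelled.mono {φ₀ : Form P} {σ : List (Assign P)} {b c : Branch P} (hc : Labelled φ₀ σ c)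
    (hbc : b ⊆ c) : Labelled φ₀ σ b := fun l hl => hc l (hbc hl)

/-- The length of the labels in a branch, if it is the same for all of them. -/
def Branch.depth (b : Branch P) : ℕ := b.sup fun l => l.1.length

lemma Labelled.depth_eq {φ₀ : Form P} {σ : List (Assign P)} {b : Branch P}
    (h : Labelled φ₀ σ b) (hne : b.Nonempty) : b.depth = σ.length := by
  have h₁ : b.depth ≤ σ.length := Finset.sup_le fun l hl => ((h l hl).1 ▸ le_rfl)
  obtain ⟨l, hl⟩ := hne
  have h₂ : l.1.length ≤ b.depth := Finset.le_sup (f := fun l : LForm P => l.1.length) hl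
  rw [(h l hl).1] at h₂
  omega

lemma Labelled.length_le {φ₀ : Form P} {σ : List (Assign P)} {b : Branch P}
    (h : Labelled φ₀ σ b) (hne : b.Nonempty) : σ.length ≤ φ₀.len := by
  obtain ⟨l, hl⟩ := hne
  have := (h l hl).2.labelSize_le fun _ => 1
  rw [(h l hl).1] at this
  exact (length_le_labelSize σ).trans this

lemma Gen.labelled {φ₀ : Form P} {σ : List (Assign P)} {b b' : Branch P} {ρ l B}
    (h : Gen b ρ l B) (hρ : ρ.IsLocal) (hb' : b' ∈ B) (hb : Labelled φ₀ σ b) :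
    Labelled φ₀ σ b' := fun l' hl' =>
  ⟨(h.label_eq hρ hb' l' hl').trans (hb l h.mem).1, h.admissible hρ hb' (hb l h.mem).2 l' hl'⟩

/-- The branch `b` contains, with label `σ`, a true literal for each variable of `φ₀`. -/
def Complete (V : Set P) (φ₀ : Form P) (σ : List (Assign P)) (b : Branch P) : Prop :=
  ∀ p ∈ φ₀.vars, ∃ v, (σ, lit p v) ∈ b ∧ LTrue V (σ, lit p v)

lemma Complete.mono {V : Set P} {φ₀ : Form P} {σ : List (Assign P)} {b c : Branch P}
    (h : Complete V φ₀ σ b) (hbc : b ⊆ c) : Complete V φ₀ σ c := fun p hp =>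
  let ⟨v, h₁, h₂⟩ := h p hp
  ⟨v, hbc h₁, h₂⟩

/-- A local rule with witness `l` has been applied in `b`, and one of the branches it generates
has been added. -/
def Expanded (b : Branch P) (l : LForm P) : Prop :=
  ∃ ρ B, ∃ b' ∈ B, Rule.IsLocal ρ ∧ Gen b ρ l B ∧ b' ⊆ b

lemma Expanded.mono {b c : Branch P} {l : LForm P} (h : Expanded b l) (hbc : b ⊆ c) :
    Expanded c l :=
  let ⟨ρ, B, b', hb', hρ, hg, hs⟩ := h
  ⟨ρ, B, b', hb', hρ, hg.mono hbc, hs.trans hbc⟩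

lemma Gen.expanded {b b' : Branch P} {ρ l B} (h : Gen b ρ l B) (hρ : ρ.IsLocal) (hb' : b' ∈ B) :
    Expanded (b ∪ b') l :=
  ⟨ρ, B, b', hb', hρ, h.mono Finset.subset_union_left, Finset.subset_union_right⟩

/-- The branch `b` is true as soon as `b₁` and the unmarked modal formulas of `b` are. -/
def Reduces (V : Set P) (b m b₁ : Branch P) : Prop :=
  (∀ l ∈ b, ∀ σ α, IsModal σ α l → l ∉ m → LTrue V l) → BTrue V b₁ → BTrue V b

/-- If no local rule is applicable, then the truth of a branch depends only on its modal formulas: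
the marked formulas follow from formulas of smaller rank, and a false literal would
be a witness to the closing rule, together with the true one. -/
lemma reduces_of_saturated {V : Set P} {φ₀ : Form P} {σ : List (Assign P)} {b m : Branch P}
    (hb : Labelled φ₀ σ b) (hc : Complete V φ₀ σ b) (hm : ∀ l ∈ m, Expanded b l)
    (h₁ : ¬ Applicable Rule.IsSingle b m) (h₂ : ¬ Applicable Rule.IsSplit b m) :
    Reduces V b m ∅ := by
  intro hmod _
  suffices H : ∀ n, ∀ l ∈ b, l.2.rank < n → LTrue V l from fun l hl => H _ l hl (Nat.lt_succ_self _)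
  intro n
  induction n with
  | zero => simp
  | succ n ih =>
    intro l hl hn
    by_cases hlm : l ∈ m
    · obtain ⟨ρ, B, b', hb', hρ, hg, hs⟩ := hm l hlm
      exact hg.ltrue hρ hb' fun l' hl' =>
        ih l' (hs hl') ((hg.rank_lt hρ hb' l' hl').trans_le (Nat.le_of_lt_succ hn))
    have single {ρ B} (hρ : ρ.IsSingle) (hg : Gen b ρ l B) : LTrue V l :=
      absurd ⟨ρ, l, B, hρ, hg, hlm⟩ h₁
    have split {ρ B} (hρ : ρ.IsSplit) (hg : Gen b ρ l B) : LTrue V l :=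
      absurd ⟨ρ, l, B, hρ, hg, hlm⟩ h₂
    obtain ⟨τ, φ⟩ := l
    obtain ⟨rfl, hadm⟩ := hb _ hl
    have hv := hadm.vars_subset
    have hsf := hadm.starFree
    cases φ with
    | var p =>
      obtain ⟨v, hv, ht⟩ := hc p (hv (by simp [Form.vars]))
      cases v
      · exact split (.inr (.inr (.inr rfl))) (.close hl hv)
      · exact ht
    | and φ ψ => exact single (by simp [Rule.IsSingle]) (.and hl)
    | box π φ =>
      cases π with
      | assign α => exact hmod _ hl _ _ ⟨_, .inl rfl⟩ hlm
      | seq => exact single (by simp [Rule.IsSingle]) (.boxSeq hl)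
      | choice => exact single (by simp [Rule.IsSingle]) (.boxChoice hl)
      | test => exact split (by simp [Rule.IsSplit]) (.boxTest hl)
      | star => exact hsf.1.elim
    | neg φ =>
      cases φ with
      | var p =>
        obtain ⟨v, hv, ht⟩ := hc p (hv (by simp [Form.vars]))
        cases v
        · exact ht
        · -- The witness of the closing rule is `p`, which cannot have been marked.
          refine absurd ⟨_, _, _, .inr (.inr (.inr rfl)), .close hv hl, fun hpm => ?_⟩ h₂
          obtain ⟨ρ, B, b', hb', hρ, hg, -⟩ := hm _ hpm
          cases hg with
          | prop1 => simp [Rule.IsLocal, Rule.IsSingle, Rule.IsSplit] at hρ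
          | close => simp at hb'
      | neg φ => exact single (by simp [Rule.IsSingle]) (.neg hl)
      | and => exact split (by simp [Rule.IsSplit]) (.or hl)
      | box π φ =>
        cases π with
        | assign α => exact hmod _ hl _ _ ⟨_, .inr rfl⟩ hlm
        | seq => exact single (by simp [Rule.IsSingle]) (.diaSeq hl)
        | choice => exact split (by simp [Rule.IsSplit]) (.diaChoice hl)
        | test => exact single (by simp [Rule.IsSingle]) (.diaTest hl)
        | star => exact hsf.1.elim

/-! ### Successors under construction -/

/-- The state of the construction of the successor `b₁` of `b` for the assignment `α`
of the witness `l`: the branch `b₁` follows from `b`, and together with the unmarked modal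
formulas it implies `b`. -/
structure SuccInv (V : Set P) (φ₀ : Form P) (σ : List (Assign P)) (α : Assign P)
    (b m : Branch P) (l : LForm P) (b₁ : Branch P) : Prop where
  mem : l ∈ b
  modal : IsModal σ α l
  nonempty : b₁.Nonempty
  labelled : Labelled φ₀ (σ ++ [α]) b₁
  lits : assignLits σ α ⊆ b₁
  reduces : Reduces V b m b₁
  sound : BTrue V b → BTrue V b₁

lemma Gen.succ_labelled {φ₀ : Form P} {σ τ : List (Assign P)} {α : Assign P} {b b₁ : Branch P}
    {ρ l} (h : Gen b ρ l {b₁}) (hρ : ρ.IsSucc) (hb : Labelled φ₀ τ b) (hl : IsModal σ α l) :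
    b₁.Nonempty ∧ Labelled φ₀ (σ ++ [α]) b₁ ∧ assignLits σ α ⊆ b₁ ∧
      ∀ V, LTrue V l ↔ BTrue V b₁ := by
  obtain ⟨σ', α', ψ, hm, hB, ht, ha⟩ := h.succ hρ
  obtain ⟨rfl, rfl⟩ := hl.unique hm
  obtain rfl := Finset.singleton_injective hB
  refine ⟨Finset.insert_nonempty _ _, fun l' hl' => ⟨?_, ha φ₀ (hb l h.mem).2 l' hl'⟩,
    Finset.subset_insert _ _, fun V => ?_⟩
  · rcases Finset.mem_insert.1 hl' with rfl | hl'
    · rfl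
    · obtain ⟨x, -, rfl⟩ := Finset.mem_image.1 hl'
      rfl
  · rw [btrue_insert, ht V]
    exact ⟨fun h => ⟨h, btrue_assignLits V _ _⟩, And.left⟩

/-- Marking `l` is harmless if what it generates is added to the successor. -/
lemma Reduces.insert {V : Set P} {b m b₁ b₂ : Branch P} {l : LForm P} (h : Reduces V b m b₁)
    (hl : BTrue V b₂ → LTrue V l) : Reduces V b (insert l m) (b₁ ∪ b₂) := by
  intro hmod ht
  refine h (fun l' hl' σ α hm hlm => ?_) (ht.mono Finset.subset_union_left)
  by_cases he : l' = l
  · subst he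
    exact hl (ht.mono Finset.subset_union_right)
  · exact hmod l' hl' σ α hm (by simp [he, hlm])

lemma SuccInv.start {V : Set P} {φ₀ : Form P} {σ : List (Assign P)} {b m b₁ : Branch P} {ρ l}
    (h : Gen b ρ l {b₁}) (hρ : ρ.IsSucc) (hb : Labelled φ₀ σ b) (hr : Reduces V b m ∅) :
    ∃ α, SuccInv V φ₀ σ α b (insert l m) l b₁ := by
  obtain ⟨σ', α, ψ, hm, -⟩ := h.succ hρ
  obtain rfl : σ' = σ := hm.label_eq.symm.trans (hb l h.mem).1
  obtain ⟨h₁, h₂, h₃, h₄⟩ := h.succ_labelled hρ hb hm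
  refine ⟨α, h.mem, hm, h₁, h₂, h₃, ?_, fun hb => (h₄ V).1 (hb l h.mem)⟩
  simpa using hr.insert (h₄ V).2

lemma SuccInv.add {V : Set P} {φ₀ : Form P} {σ : List (Assign P)} {α : Assign P}
    {b m b₁ b₂ : Branch P} {ρ l l₂} (H : SuccInv V φ₀ σ α b m l b₁) (h : Gen b ρ l₂ {b₂})
    (hρ : ρ.IsSucc) (hb : Labelled φ₀ σ b) (hl : IsModal σ α l₂) :
    SuccInv V φ₀ σ α b (insert l₂ m) l (b₁ ∪ b₂) := by
  obtain ⟨h₁, h₂, h₃, h₄⟩ := h.succ_labelled hρ hb hl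
  exact ⟨H.mem, H.modal, H.nonempty.mono Finset.subset_union_left, H.labelled.union h₂,
    H.lits.trans Finset.subset_union_left, H.reduces.insert (h₄ V).2,
    fun hb => (H.sound hb).union ((h₄ V).1 (hb l₂ h.mem))⟩

/-- Since `b` has label `σ` and `b₁` has label `σα`, propagation in `b ∪ b₁` leads from
`b` to `b₁`. -/
lemma Gen.prop_succ {φ₀ : Form P} {σ : List (Assign P)} {α : Assign P} {b b₁ : Branch P}
    {ρ l B} (h : Gen (b ∪ b₁) ρ l B) (hρ : ρ.IsProp) (hb : Labelled φ₀ σ b)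
    (hb₁ : Labelled φ₀ (σ ++ [α]) b₁) :
    ∃ p v, l = (σ, lit p v) ∧ l ∈ b ∧ p ∉ α.dom ∧ B = {{(σ ++ [α], lit p v)}} := by
  have hmem := h.mem
  obtain ⟨τ, p, v, β, ψ, rfl, hs, hp, rfl⟩ := h.prop hρ
  have len {l : LForm P} (hl : l ∈ b ∪ b₁) :
      l ∈ b ∧ l.1 = σ ∨ l ∈ b₁ ∧ l.1 = σ ++ [α] :=
    (Finset.mem_union.1 hl).imp (fun h => ⟨h, (hb l h).1⟩) fun h => ⟨h, (hb₁ l h).1⟩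
  rcases len hmem with ⟨hmem, h₁⟩ | ⟨hmem, h₁⟩ <;> rcases len hs with ⟨-, h₂⟩ | ⟨-, h₂⟩ <;>
    simp only at h₁ h₂ <;> subst h₁
  · simp at h₂
  · obtain rfl : β = α := by simpa using h₂
    exact ⟨p, v, rfl, hmem, hp, rfl⟩
  · simp at h₂
  · simp at h₂

lemma SuccInv.propagate {V : Set P} {φ₀ : Form P} {σ : List (Assign P)} {α : Assign P}
    {b m b₁ : Branch P} {l p v} (H : SuccInv V φ₀ σ α b m l b₁) (hb : Labelled φ₀ σ b)
    (hl : (σ, lit p v) ∈ b) (hp : p ∉ α.dom) :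
    SuccInv V φ₀ σ α b m l (b₁ ∪ {(σ ++ [α], lit p v)}) := by
  have hpv : p ∈ φ₀.vars := (hb _ hl).2.vars_subset (by cases v <;> simp [lit, Form.vars])
  obtain ⟨l₁, hl₁⟩ := H.nonempty
  refine ⟨H.mem, H.modal, H.nonempty.mono Finset.subset_union_left, H.labelled.union ?_,
    H.lits.trans Finset.subset_union_left,
    fun hmod ht => H.reduces hmod (ht.mono Finset.subset_union_left),
    fun ht => (H.sound ht).union ?_⟩
  · intro l' hl'
    obtain rfl := Finset.mem_singleton.1 hl'
    refine ⟨rfl, admissible_lit hpv v fun ν => ?_⟩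
    have := (H.labelled l₁ hl₁).2.labelSize_le ν
    rwa [(H.labelled l₁ hl₁).1] at this
  · have := ht _ hl
    simpa [LTrue, sat_lit, Assign.mem_update_iff_of_notMem hp] using this

/-- When no literal is left to propagate, the successor is complete. -/
lemma SuccInv.complete {V : Set P} {φ₀ : Form P} {σ : List (Assign P)} {α : Assign P}
    {b m b₁ d : Branch P} {l} (H : SuccInv V φ₀ σ α b m l b₁) (hc : Complete V φ₀ σ b)
    (hd : ∀ p v, (σ, lit p v) ∈ d → (σ ++ [α], lit p v) ∈ b₁)
    (hend : ¬ Applicable Rule.IsProp (b ∪ b₁) d) : Complete V φ₀ (σ ++ [α]) b₁ := by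
  intro p hp
  by_cases hα : p ∈ α.dom
  · obtain ⟨v, hv⟩ := hα
    have : (σ ++ [α], lit p v) ∈ assignLits σ α := Finset.mem_image.2 ⟨_, hv, rfl⟩
    exact ⟨v, H.lits this, btrue_assignLits V σ α _ this⟩
  · obtain ⟨v, hv, ht⟩ := hc p hp
    refine ⟨v, hd p v ?_, ?_⟩
    · by_contra hvd
      obtain ⟨l₁, hl₁⟩ := H.nonempty
      have h₁ : (σ ++ [α], l₁.2) ∈ b ∪ b₁ := by
        rw [← (H.labelled l₁ hl₁).1]
        exact Finset.mem_union_right _ hl₁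
      obtain ⟨ρ, B, hρ, hg⟩ := gen_prop (Finset.mem_union_left _ hv) h₁ hα
      exact hend ⟨ρ, _, B, hρ, hg, hvd⟩
    · simpa [LTrue, sat_lit, Assign.mem_update_iff_of_notMem hα] using ht

/-! ### The invariant of the call stack -/

/-- The invariant of the local variables of an activation with argument `b` and marks `m`. -/
def CtrlInv (V : Set P) (φ₀ : Form P) (σ : List (Assign P)) (b m : Branch P) : Ctrl P → Prop
  | .test => ∀ l ∈ m, Expanded b l
  | .awaitSingle b₁ => (BTrue V b → BTrue V b₁) ∧ Labelled φ₀ σ b₁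
  | .each B => (BTrue V b → ∃ b' ∈ B, BTrue V b') ∧
      (∀ b' ∈ B, Labelled φ₀ σ b' ∧ ∀ l ∈ m, Expanded (b ∪ b') l) ∧ B.card ≤ 2
  | .awaitSplit bᵢ B => (BTrue V b → BTrue V bᵢ ∨ ∃ b' ∈ B, BTrue V b') ∧ Labelled φ₀ σ bᵢ ∧
      (∀ b' ∈ B, Labelled φ₀ σ b' ∧ ∀ l ∈ m, Expanded (b ∪ b') l) ∧ B.card ≤ 1
  | .outer => Reduces V b m ∅
  | .inner l b₁ => ∃ α, SuccInv V φ₀ σ α b m l b₁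
  | .prop l b₁ d => ∃ α, SuccInv V φ₀ σ α b m l b₁ ∧ d ⊆ b ∧
      ∀ p v, (σ, lit p v) ∈ d → (σ ++ [α], lit p v) ∈ b₁
  | .awaitSucc l b₁ => ∃ α, SuccInv V φ₀ σ α b m l b₁

/-- The invariant of an activation record whose branch has label `σ`. -/
structure FrameInv (V : Set P) (φ₀ : Form P) (σ : List (Assign P)) (f : Frame P) : Prop where
  nonempty : f.b.Nonempty
  labelled : Labelled φ₀ σ f.b
  complete : Complete V φ₀ σ f.b
  marked_subset : f.marked ⊆ f.b
  ctrl : CtrlInv V φ₀ σ f.b f.marked f.ctrl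

/-- The argument of the recursive call whose value is being waited for. -/
def Frame.callee (f : Frame P) : Option (Branch P) :=
  match f.ctrl with
  | .awaitSingle b₁ => some (f.b ∪ b₁)
  | .awaitSplit bᵢ _ => some (f.b ∪ bᵢ)
  | .awaitSucc _ b₁ => some b₁
  | _ => none

/-- The progress of an activation, measured by its depth and its marks. There are at most as many
marks as allowed formulas, so a step to a greater depth outweighs the loss of all marks. -/
def Frame.level (φ₀ : Form P) (f : Frame P) : ℕ :=
  f.b.depth * ((allowed φ₀).card + 1) + f.marked.card

/-- By how much the level of an activation has to exceed its height in the stack. From the marking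
of a witness of a local rule on this is `1`: a recursive call for that witness is higher by one and
starts with the same level. A call for a successor starts with a higher level. -/
def Ctrl.debt : Ctrl P → ℕ
  | .awaitSingle _ | .each _ | .awaitSplit _ _ => 1
  | _ => 0

/-- The invariant of a stack of waiting activations, the topmost of which waits for the value of
`mcTableau b`. The level of an activation bounds its height in the stack. -/
def StackInv (V : Set P) (φ₀ : Form P) : List (Frame P) → Branch P → Prop
  | [], b => b = initBranch V φ₀
  | f :: s, b => (∃ σ, FrameInv V φ₀ σ f) ∧ f.callee = some b ∧
      s.length + f.ctrl.debt ≤ f.level φ₀ ∧ StackInv V φ₀ s f.b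

/-- The invariant of configurations: a call of `mcTableau b` returns `true` if and only if `b` is
true. -/
def ConfigInv (V : Set P) (φ₀ : Form P) : Config P → Prop
  | .run [] => False
  | .run (f :: s) => (∃ σ, FrameInv V φ₀ σ f) ∧ f.callee = none ∧
      s.length + f.ctrl.debt ≤ f.level φ₀ ∧ StackInv V φ₀ s f.b
  | .ret v s => ∃ b, (v = true ↔ BTrue V b) ∧ StackInv V φ₀ s b

lemma configInv_init (V : Set P) {φ₀ : Form P} (h : φ₀.StarFree) :
    ConfigInv V φ₀ (initConfig V φ₀) := by
  refine ⟨⟨[], ⟨([], φ₀), Finset.mem_insert_self _ _⟩, ?_, ?_, Finset.empty_subset _, ?_⟩, rfl,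
    by simp [Ctrl.debt], rfl⟩
  · intro l hl
    rcases Finset.mem_insert.1 hl with rfl | hl
    · exact ⟨rfl, admissible_self h⟩
    · obtain ⟨p, hp, rfl⟩ := Finset.mem_image.1 hl
      exact ⟨rfl, admissible_lit hp _ (by simp [labelSize])⟩
  · intro p hp
    exact ⟨_, Finset.mem_insert_of_mem (Finset.mem_image_of_mem _ hp), by simp [LTrue, sat_lit]⟩
  · simp [CtrlInv]

lemma btrue_initBranch (V : Set P) (φ₀ : Form P) : BTrue V (initBranch V φ₀) ↔ φ₀.Sat V := by
  refine ⟨fun h => h _ (Finset.mem_insert_self _ _), fun h => ?_⟩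
  intro l hl
  rcases Finset.mem_insert.1 hl with rfl | hl
  · exact h
  · obtain ⟨p, hp, rfl⟩ := Finset.mem_image.1 hl
    simp [LTrue, sat_lit]

/-! ### Preservation of the invariant -/

lemma FrameInv.card_marked_le {V : Set P} {φ₀ : Form P} {σ : List (Assign P)} {f : Frame P}
    (h : FrameInv V φ₀ σ f) : f.marked.card ≤ (allowed φ₀).card :=
  (Finset.card_le_card h.marked_subset).trans h.labelled.card_le

lemma FrameInv.level_eq {V : Set P} {φ₀ : Form P} {σ : List (Assign P)} {f : Frame P}
    (h : FrameInv V φ₀ σ f) :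
    f.level φ₀ = σ.length * ((allowed φ₀).card + 1) + f.marked.card := by
  rw [Frame.level, h.labelled.depth_eq h.nonempty]

/-- Truth of a branch is equivalent to truth of an extension that follows from it. -/
lemma btrue_union_iff {V : Set P} {b b₁ : Branch P} (h : BTrue V b → BTrue V b₁) :
    BTrue V (b ∪ b₁) ↔ BTrue V b :=
  ⟨fun h' => h'.mono Finset.subset_union_left, fun h' => h'.union (h h')⟩

lemma ConfigInv.step {V : Set P} {φ₀ : Form P} {c c' : Config P} (h : ConfigInv V φ₀ c)
    (hs : Step c c') : ConfigInv V φ₀ c' := by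
  cases hs with
  | @single b m b₁ s ρ l hρ hg hl =>
    obtain ⟨⟨σ, hf⟩, -, hlen, hst⟩ := h
    have hmb : insert l m ⊆ b := Finset.insert_subset hg.mem hf.marked_subset
    have hb₁ : Labelled φ₀ σ b₁ := hg.labelled (.inl hρ) (by simp) hf.labelled
    have hw : FrameInv V φ₀ σ ⟨b, insert l m, .awaitSingle b₁⟩ := by
      refine ⟨hf.nonempty, hf.labelled, hf.complete, hmb, fun ht => ?_, hb₁⟩
      simpa using hg.exists_btrue (.inl hρ) ht
    have hc : FrameInv V φ₀ σ ⟨b ∪ b₁, insert l m, .test⟩ := by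
      refine ⟨hf.nonempty.mono Finset.subset_union_left, hf.labelled.union hb₁,
        hf.complete.mono Finset.subset_union_left, hmb.trans Finset.subset_union_left, ?_⟩
      intro l' hl'
      rcases Finset.mem_insert.1 hl' with rfl | hl'
      · exact hg.expanded (.inl hρ) (by simp)
      · exact (hf.ctrl l' hl').mono Finset.subset_union_left
    rw [hf.level_eq] at hlen
    simp only [Ctrl.debt] at hlen
    refine ⟨⟨σ, hc⟩, rfl, ?_, ⟨σ, hw⟩, rfl, ?_, hst⟩
    · rw [hc.level_eq]
      simp [Ctrl.debt, Finset.card_insert_of_notMem hl]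
      omega
    · rw [hw.level_eq]
      simp [Ctrl.debt, Finset.card_insert_of_notMem hl]
      omega
  | @singleRet b m b₁ s v =>
    obtain ⟨b', hv, ⟨σ, hf⟩, hb', -, hst⟩ := h
    obtain rfl : b ∪ b₁ = b' := Option.some_injective _ hb'
    exact ⟨b, hv.trans (btrue_union_iff hf.ctrl.1), hst⟩
  | @split b m s ρ l B _ hρ hg hl =>
    obtain ⟨⟨σ, hf⟩, -, hlen, hst⟩ := h
    have hc : FrameInv V φ₀ σ ⟨b, insert l m, .each B⟩ := by
      refine ⟨hf.nonempty, hf.labelled, hf.complete,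
        Finset.insert_subset hg.mem hf.marked_subset, hg.exists_btrue (.inr hρ),
        fun b' hb' => ⟨hg.labelled (.inr hρ) hb' hf.labelled, fun l' hl' => ?_⟩, hg.card_le⟩
      rcases Finset.mem_insert.1 hl' with rfl | hl'
      · exact hg.expanded (.inr hρ) hb'
      · exact (hf.ctrl l' hl').mono Finset.subset_union_left
    rw [hf.level_eq] at hlen
    simp only [Ctrl.debt] at hlen
    refine ⟨⟨σ, hc⟩, rfl, ?_, hst⟩
    rw [hc.level_eq]
    simp [Ctrl.debt, Finset.card_insert_of_notMem hl]
    omega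
  | @eachCall b m bᵢ s B hbᵢ =>
    obtain ⟨⟨σ, hf⟩, -, hlen, hst⟩ := h
    obtain ⟨hB, hB', hcard⟩ := hf.ctrl
    have hw : FrameInv V φ₀ σ ⟨b, m, .awaitSplit bᵢ (B.erase bᵢ)⟩ := by
      refine ⟨hf.nonempty, hf.labelled, hf.complete, hf.marked_subset, fun ht => ?_,
        (hB' bᵢ hbᵢ).1, fun b' hb' => hB' b' (Finset.mem_of_mem_erase hb'), ?_⟩
      · obtain ⟨b', hb', ht'⟩ := hB ht
        by_cases he : b' = bᵢ
        · exact .inl (he ▸ ht')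
        · exact .inr ⟨b', Finset.mem_erase.2 ⟨he, hb'⟩, ht'⟩
      · rw [Finset.card_erase_of_mem hbᵢ]
        omega
    have hc : FrameInv V φ₀ σ ⟨b ∪ bᵢ, m, .test⟩ :=
      ⟨hf.nonempty.mono Finset.subset_union_left, hf.labelled.union (hB' bᵢ hbᵢ).1,
        hf.complete.mono Finset.subset_union_left,
        hf.marked_subset.trans Finset.subset_union_left, (hB' bᵢ hbᵢ).2⟩
    rw [hf.level_eq] at hlen
    refine ⟨⟨σ, hc⟩, rfl, ?_, ⟨σ, hw⟩, rfl, ?_, hst⟩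
    · rw [hc.level_eq]
      exact hlen
    · rw [hw.level_eq]
      exact hlen
  | @eachTrue b m bᵢ s B =>
    obtain ⟨b', hv, ⟨σ, hf⟩, hb', -, hst⟩ := h
    obtain rfl : b ∪ bᵢ = b' := Option.some_injective _ hb'
    exact ⟨b, by simpa using (hv.1 rfl).mono Finset.subset_union_left, hst⟩
  | @eachFalse b m bᵢ s B =>
    obtain ⟨b', hv, ⟨σ, hf⟩, hb', hlen, hst⟩ := h
    obtain rfl : b ∪ bᵢ = b' := Option.some_injective _ hb'
    obtain ⟨hB, -, hB', hcard⟩ := hf.ctrl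
    refine ⟨⟨σ, hf.nonempty, hf.labelled, hf.complete, hf.marked_subset, fun ht => ?_, hB',
      hcard.trans one_le_two⟩, rfl, hlen, hst⟩
    exact (hB ht).resolve_left fun h' => by simpa using hv.2 (ht.union h')
  | @eachEnd b m s =>
    obtain ⟨⟨σ, hf⟩, -, -, hst⟩ := h
    exact ⟨b, by simpa using fun ht => hf.ctrl.1 ht, hst⟩
  | @local_end b m s h₁ h₂ =>
    obtain ⟨⟨σ, hf⟩, -, hlen, hst⟩ := h
    exact ⟨⟨σ, hf.nonempty, hf.labelled, hf.complete, hf.marked_subset,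
      reduces_of_saturated hf.labelled hf.complete hf.ctrl h₁ h₂⟩, rfl, hlen, hst⟩
  | @outer b m b₁ s ρ l hρ hg hl =>
    obtain ⟨⟨σ, hf⟩, -, hlen, hst⟩ := h
    have hc : FrameInv V φ₀ σ ⟨b, insert l m, .inner l b₁⟩ :=
      ⟨hf.nonempty, hf.labelled, hf.complete, Finset.insert_subset hg.mem hf.marked_subset,
        SuccInv.start hg hρ hf.labelled hf.ctrl⟩
    rw [hf.level_eq] at hlen
    simp only [Ctrl.debt] at hlen
    refine ⟨⟨σ, hc⟩, rfl, ?_, hst⟩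
    rw [hc.level_eq]
    simp [Ctrl.debt, Finset.card_insert_of_notMem hl]
    omega
  | @inner b m b₁ b₂ s ρ l l₂ τ α hl hl₂ hρ hg hlm =>
    obtain ⟨⟨σ, hf⟩, -, hlen, hst⟩ := h
    obtain ⟨β, H⟩ := hf.ctrl
    obtain ⟨rfl, rfl⟩ := H.modal.unique hl
    have hc : FrameInv V φ₀ σ ⟨b, insert l₂ m, .inner l (b₁ ∪ b₂)⟩ :=
      ⟨hf.nonempty, hf.labelled, hf.complete, Finset.insert_subset hg.mem hf.marked_subset, β,
        H.add hg hρ hf.labelled hl₂⟩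
    rw [hf.level_eq] at hlen
    simp only [Ctrl.debt] at hlen
    refine ⟨⟨σ, hc⟩, rfl, ?_, hst⟩
    rw [hc.level_eq]
    simp [Ctrl.debt, Finset.card_insert_of_notMem hlm]
    omega
  | @innerEnd b m b₁ s l _ =>
    obtain ⟨⟨σ, hf⟩, -, hlen, hst⟩ := h
    obtain ⟨α, H⟩ := hf.ctrl
    exact ⟨⟨σ, hf.nonempty, hf.labelled, hf.complete, hf.marked_subset, α, H,
      Finset.empty_subset _, by simp⟩, rfl, hlen, hst⟩
  | @prop b m b₁ b₂ d s ρ l l₂ hρ hg hl =>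
    obtain ⟨⟨σ, hf⟩, -, hlen, hst⟩ := h
    obtain ⟨α, H, hd, hd'⟩ := hf.ctrl
    obtain ⟨p, v, rfl, hmem, hp, hB⟩ := hg.prop_succ hρ hf.labelled H.labelled
    obtain rfl := Finset.singleton_injective hB
    refine ⟨⟨σ, hf.nonempty, hf.labelled, hf.complete, hf.marked_subset, α,
      H.propagate hf.labelled hmem hp, Finset.insert_subset hmem hd, ?_⟩, rfl, hlen, hst⟩
    intro q w hq
    rcases Finset.mem_insert.1 hq with hq | hq
    · rw [(Prod.mk.inj hq).2]
      simp
    · exact Finset.mem_union_left _ (hd' q w hq)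
  | @propEnd b m b₁ d s l hend =>
    obtain ⟨⟨σ, hf⟩, -, hlen, hst⟩ := h
    obtain ⟨α, H, hd, hd'⟩ := hf.ctrl
    have hc : FrameInv V φ₀ (σ ++ [α]) ⟨b₁, ∅, .test⟩ :=
      ⟨H.nonempty, H.labelled, H.complete hf.complete hd' hend, Finset.empty_subset _,
        by simp [CtrlInv]⟩
    refine ⟨⟨_, hc⟩, rfl, ?_, ⟨σ, hf.nonempty, hf.labelled, hf.complete, hf.marked_subset, α, H⟩,
      rfl, hlen, hst⟩
    -- The marks are lost, but the label is longer by one.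
    have hm := hf.card_marked_le
    rw [hf.level_eq] at hlen
    rw [hc.level_eq]
    simp [Ctrl.debt, add_mul] at hlen hm ⊢
    omega
  | @succFalse b m b₁ s l =>
    obtain ⟨b', hv, ⟨σ, hf⟩, hb', -, hst⟩ := h
    obtain rfl : b₁ = b' := Option.some_injective _ hb'
    obtain ⟨α, H⟩ := hf.ctrl
    exact ⟨b, by simpa using fun ht => hv.2 (H.sound ht), hst⟩
  | @succTrue b m b₁ s l =>
    obtain ⟨b', hv, ⟨σ, hf⟩, hb', hlen, hst⟩ := h
    obtain rfl : b₁ = b' := Option.some_injective _ hb'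
    obtain ⟨α, H⟩ := hf.ctrl
    exact ⟨⟨σ, hf.nonempty, hf.labelled, hf.complete, hf.marked_subset,
      fun hmod _ => H.reduces hmod (hv.1 rfl)⟩, rfl, hlen, hst⟩
  | @outerEnd b m s hend =>
    obtain ⟨⟨σ, hf⟩, -, -, hst⟩ := h
    have ht : BTrue V b := by
      refine hf.ctrl (fun l hl τ α hm hlm => ?_) (by simp [BTrue])
      obtain ⟨ρ, B, hρ, hg⟩ := hm.gen hl
      exact absurd ⟨ρ, l, B, hρ, hg, hlm⟩ hend
    exact ⟨b, by simpa using ht, hst⟩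

lemma Gen.eq_singleton_of_single {b : Branch P} {ρ l B} (h : Gen b ρ l B) (hρ : ρ.IsSingle) :
    ∃ b₁, B = {b₁} := by
  cases h with
  | neg | and | diaTest | boxSeq | diaSeq | boxChoice => exact ⟨_, rfl⟩
  | or | boxTest | diaChoice | boxAssign | diaAssign | prop1 | prop2 | close =>
    simp [Rule.IsSingle] at hρ

/-- The algorithm does not get stuck. -/
lemma ConfigInv.eq_ret_of_forall_not_step {V : Set P} {φ₀ : Form P} {c : Config P}
    (h : ConfigInv V φ₀ c) (hs : ∀ e, ¬ Step c e) :
    ∃ v : Bool, c = .ret v [] ∧ (v = true ↔ φ₀.Sat V) := by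
  match c, h with
  | .ret v [], ⟨_, hv, rfl⟩ => exact ⟨v, rfl, hv.trans (btrue_initBranch V φ₀)⟩
  | .ret v (⟨b, m, k⟩ :: s), ⟨b', hv, _, hb', _⟩ =>
    cases k with
    | awaitSingle b₁ => exact absurd .singleRet (hs _)
    | awaitSplit bᵢ B =>
      cases v
      · exact absurd .eachFalse (hs _)
      · exact absurd .eachTrue (hs _)
    | awaitSucc l b₁ =>
      cases v
      · exact absurd .succFalse (hs _)
      · exact absurd .succTrue (hs _)
    | test | each | outer | inner | prop => simp [Frame.callee] at hb'
  | .run (⟨b, m, k⟩ :: s), ⟨_, hk, _⟩ =>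
    exfalso
    cases k with
    | awaitSingle b₁ | awaitSplit bᵢ B | awaitSucc l b₁ => simp [Frame.callee] at hk
    | test =>
      by_cases h₁ : Applicable Rule.IsSingle b m
      · obtain ⟨ρ, l, B, hρ, hg, hl⟩ := h₁
        obtain ⟨b₁, rfl⟩ := hg.eq_singleton_of_single hρ
        exact hs _ (.single hρ hg hl)
      by_cases h₂ : Applicable Rule.IsSplit b m
      · obtain ⟨ρ, l, B, hρ, hg, hl⟩ := h₂
        exact hs _ (.split h₁ hρ hg hl)
      · exact hs _ (.local_end h₁ h₂)
    | each B =>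
      rcases B.eq_empty_or_nonempty with rfl | ⟨bᵢ, hbᵢ⟩
      · exact hs _ .eachEnd
      · exact hs _ (.eachCall hbᵢ)
    | outer =>
      by_cases h₁ : Applicable Rule.IsSucc b m
      · obtain ⟨ρ, l, B, hρ, hg, hl⟩ := h₁
        obtain ⟨σ, α, ψ, -, rfl, -⟩ := hg.succ hρ
        exact hs _ (.outer hρ hg hl)
      · exact hs _ (.outerEnd h₁)
    | inner l b₁ =>
      by_cases h₁ : ∃ ρ l₂ B σ α, IsModal σ α l ∧ IsModal σ α l₂ ∧ Rule.IsSucc ρ ∧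
          Gen b ρ l₂ B ∧ l₂ ∉ m
      · obtain ⟨ρ, l₂, B, σ, α, hl, hl₂, hρ, hg, hlm⟩ := h₁
        obtain ⟨σ', α', ψ, -, rfl, -⟩ := hg.succ hρ
        exact hs _ (.inner hl hl₂ hρ hg hlm)
      · exact hs _ (.innerEnd h₁)
    | prop l b₁ d =>
      by_cases h₁ : Applicable Rule.IsProp (b ∪ b₁) d
      · obtain ⟨ρ, l₂, B, hρ, hg, hl⟩ := h₁
        obtain ⟨σ, p, v, α, ψ, -, -, -, rfl⟩ := hg.prop hρ
        exact hs _ (.prop hρ hg hl)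
      · exact hs _ (.propEnd h₁)

/-! ### Termination -/

/-- A bound for the number of steps of a call of `mcTableau` when branches have at most `N` elements
and the level can still increase by `r`. The factor `N + 2` is large enough for the two calls of a
splitting rule as well as for one call for each of at most `N` modal formulas, and `N + 6` covers
the steps in between, such as the propagation of at most `N` literals. -/
def callBound (N : ℕ) : ℕ → ℕ
  | 0 => 0
  | r + 1 => (N + 2) * (callBound N r + N + 6) + 2

lemma callBound_mono (N : ℕ) : Monotone (callBound N) := by
  refine monotone_nat_of_le_succ fun r => ?_
  rw [callBound]
  nlinarith [Nat.zero_le (callBound N r)]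

/-- A bound for the number of steps that an activation can still cause, excluding those of the
recursive call it waits for: `r` is the possible increase of the level, `R` that of the level of a
successor, and `w` is the number of unmarked formulas. -/
def Ctrl.weight (N r R w : ℕ) : Ctrl P → ℕ
  | .test => callBound N r
  | .awaitSingle _ => 1
  | .each B => 1 + B.card * (callBound N r + 2)
  | .awaitSplit _ B => 2 + B.card * (callBound N r + 2)
  | .outer => 1 + w * (callBound N R + N + 5)
  | .inner _ _ => 1 + w * (callBound N R + N + 5) + callBound N R + N + 4
  | .prop _ _ d => 1 + w * (callBound N R + N + 5) + callBound N R + (N - d.card) + 3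
  | .awaitSucc _ _ => 1 + w * (callBound N R + N + 5) + 1

/-- `Ctrl.weight` with the parameters of an activation in a run on `φ₀`. -/
def Frame.weight (φ₀ : Form P) (f : Frame P) : ℕ :=
  let N := (allowed φ₀).card
  let R := (φ₀.len - f.b.depth) * (N + 1)
  f.ctrl.weight N (R + (N + 1 - f.marked.card)) R (f.b \ f.marked).card

/-- The total weight of the activations in a configuration. -/
def Config.weight (φ₀ : Form P) (c : Config P) : ℕ := (c.stack.map (Frame.weight φ₀)).sum

lemma card_sdiff_insert {b m : Branch P} {l : LForm P} (hl : l ∈ b) (hm : l ∉ m) :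
    (b \ insert l m).card + 1 = (b \ m).card := by
  rw [Finset.sdiff_insert, Finset.card_erase_add_one (Finset.mem_sdiff.2 ⟨hl, hm⟩)]

lemma ConfigInv.weight_lt {V : Set P} {φ₀ : Form P} {c c' : Config P} (h : ConfigInv V φ₀ c)
    (hs : Step c c') : c'.weight φ₀ < c.weight φ₀ := by
  cases hs with
  | @single b m b₁ s ρ l hρ hg hl =>
    obtain ⟨⟨σ, hf⟩, -⟩ := h
    have hb₁ : Labelled φ₀ σ b₁ := hg.labelled (.inl hρ) (by simp) hf.labelled
    have hm : (insert l m).card ≤ (allowed φ₀).card :=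
      (hf.labelled.mono (Finset.insert_subset hg.mem hf.marked_subset)).card_le
    have hd := hf.labelled.depth_eq hf.nonempty
    have hd' := (hf.labelled.union hb₁).depth_eq (hf.nonempty.mono Finset.subset_union_left)
    simp only [Config.weight, Config.stack, List.map_cons, List.sum_cons, Frame.weight,
      Ctrl.weight, hd, hd']
    rw [Finset.card_insert_of_notMem hl] at hm ⊢
    generalize (allowed φ₀).card = N at *
    -- The mark uses up one unit of the possible increase of the level.
    obtain ⟨k, rfl⟩ := Nat.exists_eq_add_of_le hm
    rw [show m.card + 1 + k + 1 - m.card = k + 1 + 1 by omega,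
      show m.card + 1 + k + 1 - (m.card + 1) = k + 1 by omega, ← add_assoc _ (k + 1) 1, callBound]
    nlinarith
  | @split b m s ρ l B _ hρ hg hl =>
    obtain ⟨⟨σ, hf⟩, -⟩ := h
    have hm : (insert l m).card ≤ (allowed φ₀).card :=
      (hf.labelled.mono (Finset.insert_subset hg.mem hf.marked_subset)).card_le
    have hB := hg.card_le
    simp only [Config.weight, Config.stack, List.map_cons, List.sum_cons, Frame.weight,
      Ctrl.weight]
    rw [Finset.card_insert_of_notMem hl] at hm ⊢
    generalize (allowed φ₀).card = N at *
    obtain ⟨k, rfl⟩ := Nat.exists_eq_add_of_le hm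
    rw [show m.card + 1 + k + 1 - m.card = k + 1 + 1 by omega,
      show m.card + 1 + k + 1 - (m.card + 1) = k + 1 by omega, ← add_assoc _ (k + 1) 1, callBound]
    generalize callBound _ _ = T
    have : B.card * (T + 2) ≤ 2 * (T + 2) := Nat.mul_le_mul_right _ hB
    nlinarith
  | @eachCall b m bᵢ s B hbᵢ =>
    obtain ⟨⟨σ, hf⟩, -⟩ := h
    have hd := hf.labelled.depth_eq hf.nonempty
    have hd' := (hf.labelled.union (hf.ctrl.2.1 bᵢ hbᵢ).1).depth_eq
      (hf.nonempty.mono Finset.subset_union_left)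
    simp only [Config.weight, Config.stack, List.map_cons, List.sum_cons, Frame.weight,
      Ctrl.weight, hd, hd']
    rw [← Finset.card_erase_add_one hbᵢ]
    generalize callBound _ _ = T
    rw [add_mul]
    omega
  | @local_end b m s h₁ h₂ =>
    obtain ⟨⟨σ, hf⟩, -⟩ := h
    have hm := hf.card_marked_le
    have hw : (b \ m).card ≤ (allowed φ₀).card :=
      (hf.labelled.mono Finset.sdiff_subset).card_le
    simp only [Config.weight, Config.stack, List.map_cons, List.sum_cons, Frame.weight,
      Ctrl.weight] at hm ⊢
    generalize (allowed φ₀).card = N at *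
    rw [show N + 1 - m.card = (N - m.card) + 1 by omega, ← add_assoc _ _ 1, callBound]
    have := callBound_mono N (Nat.le_add_right ((φ₀.len - b.depth) * (N + 1)) (N - m.card))
    revert this
    generalize callBound _ _ = T
    generalize callBound _ _ = T'
    intro hT
    have : (b \ m).card * (T + N + 5) ≤ N * (T' + N + 6) := Nat.mul_le_mul hw (by omega)
    nlinarith
  | @outer b m b₁ s ρ l hρ hg hl =>
    have hw := card_sdiff_insert hg.mem hl
    simp only [Config.weight, Config.stack, List.map_cons, List.sum_cons, Frame.weight,
      Ctrl.weight, ← hw]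
    rw [add_mul (b \ insert l m).card]
    omega
  | @inner b m b₁ b₂ s ρ l l₂ τ α hl hl₂ hρ hg hlm =>
    have hw := card_sdiff_insert hg.mem hlm
    simp only [Config.weight, Config.stack, List.map_cons, List.sum_cons, Frame.weight,
      Ctrl.weight, ← hw]
    rw [add_mul (b \ insert l₂ m).card]
    omega
  | @prop b m b₁ b₂ d s ρ l l₂ hρ hg hl =>
    obtain ⟨⟨σ, hf⟩, -⟩ := h
    obtain ⟨α, H, hd, hd'⟩ := hf.ctrl
    obtain ⟨p, v, -, hmem, -⟩ := hg.prop_succ hρ hf.labelled H.labelled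
    have hd₂ : (insert l₂ d).card ≤ (allowed φ₀).card :=
      (hf.labelled.mono (Finset.insert_subset hmem hd)).card_le
    rw [Finset.card_insert_of_notMem hl] at hd₂
    simp only [Config.weight, Config.stack, List.map_cons, List.sum_cons, Frame.weight,
      Ctrl.weight, Finset.card_insert_of_notMem hl]
    omega
  | @propEnd b m b₁ d s l hend =>
    obtain ⟨⟨σ, hf⟩, -⟩ := h
    obtain ⟨α, H, -⟩ := hf.ctrl
    have hn := H.labelled.length_le H.nonempty
    have hd := hf.labelled.depth_eq hf.nonempty
    have hd' := H.labelled.depth_eq H.nonempty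
    rw [List.length_append, List.length_singleton] at hn hd'
    simp only [Config.weight, Config.stack, List.map_cons, List.sum_cons, Frame.weight,
      Ctrl.weight, hd, hd', Finset.card_empty, Nat.sub_zero]
    -- The successor starts without marks, so its call has weight `callBound N R` for the value of
    -- `R` of the calling activation.
    rw [show φ₀.len - σ.length = φ₀.len - (σ.length + 1) + 1 by omega,
      add_mul _ 1 ((allowed φ₀).card + 1), one_mul]
    omega
  | singleRet | eachTrue | eachFalse | eachEnd | innerEnd | succFalse | succTrue | outerEnd =>
    simp only [Config.weight, Config.stack, List.map_cons, List.sum_cons, Frame.weight,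
      Ctrl.weight, Finset.card_empty]
    omega

/-! ### Memory -/

lemma Labelled.mem_le {φ₀ : Form P} {σ : List (Assign P)} {b : Branch P} (h : Labelled φ₀ σ b)
    {k : LForm P → ℕ} {M : ℕ} (hk : ∀ l, Admissible φ₀ l → k l ≤ M) :
    b.mem k ≤ M * (allowed φ₀).card := by
  refine (Finset.sum_le_card_nsmul b k M fun l hl => hk l (h l hl).2).trans ?_
  rw [smul_eq_mul, mul_comm]
  exact Nat.mul_le_mul_left _ h.card_le

/-- A record holds its branch, its marks, and local variables that amount to at most two further
branches and a witness. -/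
lemma FrameInv.mem_le {V : Set P} {φ₀ : Form P} {σ : List (Assign P)} {f : Frame P}
    (h : FrameInv V φ₀ σ f) {k : LForm P → ℕ} {M : ℕ} (hM : 1 ≤ M)
    (hk : ∀ l, Admissible φ₀ l → k l ≤ M) :
    f.mem k ≤ M * (4 * (allowed φ₀).card + 2) := by
  have hb := h.labelled.mem_le hk
  have hm := (h.labelled.mono h.marked_subset).mem_le hk
  have sum {B : Finset (Branch P)} {n : ℕ} (hB : ∀ b ∈ B, Labelled φ₀ σ b) (hn : B.card ≤ n) :
      ∑ b ∈ B, Branch.mem k b ≤ n * (M * (allowed φ₀).card) :=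
    (Finset.sum_le_card_nsmul B _ _ fun b hb => (hB b hb).mem_le hk).trans
      (Nat.mul_le_mul_right _ hn)
  have hc : f.ctrl.mem k ≤ M + 2 * (M * (allowed φ₀).card) := by
    have hctrl := h.ctrl
    cases hf : f.ctrl <;> simp only [hf, CtrlInv] at hctrl <;> simp only [Ctrl.mem]
    case test | outer => omega
    case awaitSingle =>
      have := hctrl.2.mem_le hk
      omega
    case each =>
      have := sum (fun b hb => (hctrl.2.1 b hb).1) hctrl.2.2
      omega
    case awaitSplit =>
      have h₁ := sum (fun b hb => (hctrl.2.2.1 b hb).1) hctrl.2.2.2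
      have h₂ := hctrl.2.1.mem_le hk
      omega
    case inner | awaitSucc =>
      obtain ⟨α, H⟩ := hctrl
      have h₁ := hk _ (h.labelled _ H.mem).2
      have h₂ := H.labelled.mem_le hk
      omega
    case prop =>
      obtain ⟨α, H, hd, -⟩ := hctrl
      have h₁ := hk _ (h.labelled _ H.mem).2
      have h₂ := H.labelled.mem_le hk
      have h₃ := (h.labelled.mono hd).mem_le hk
      omega
  rw [Frame.mem]
  nlinarith

lemma FrameInv.level_lt {V : Set P} {φ₀ : Form P} {σ : List (Assign P)} {f : Frame P}
    (h : FrameInv V φ₀ σ f) : f.level φ₀ < (φ₀.len + 1) * ((allowed φ₀).card + 1) := by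
  have h₁ := h.card_marked_le
  have h₂ := Nat.mul_le_mul_right ((allowed φ₀).card + 1) (h.labelled.length_le h.nonempty)
  rw [h.level_eq, add_mul]
  omega

lemma StackInv.frames {V : Set P} {φ₀ : Form P} {s : List (Frame P)} {b : Branch P}
    (h : StackInv V φ₀ s b) : ∀ f ∈ s, ∃ σ, FrameInv V φ₀ σ f := by
  induction s generalizing b with
  | nil => simp
  | cons f s ih => exact List.forall_mem_cons.2 ⟨h.1, ih h.2.2.2⟩

lemma ConfigInv.stack {V : Set P} {φ₀ : Form P} {c : Config P} (h : ConfigInv V φ₀ c) :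
    (∀ f ∈ c.stack, ∃ σ, FrameInv V φ₀ σ f) ∧
      c.stack.length ≤ (φ₀.len + 1) * ((allowed φ₀).card + 1) := by
  match c, h with
  | .run (f :: s), ⟨⟨σ, hf⟩, _, hlen, hst⟩ =>
    refine ⟨List.forall_mem_cons.2 ⟨⟨σ, hf⟩, hst.frames⟩, ?_⟩
    have := hf.level_lt
    simp only [Config.stack, List.length_cons]
    omega
  | .ret v [], _ => simp [Config.stack]
  | .ret v (f :: s), ⟨b, _, hst⟩ =>
    refine ⟨hst.frames, ?_⟩
    obtain ⟨⟨σ, hf⟩, -, hlen, -⟩ := hst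
    have := hf.level_lt
    simp only [Config.stack, List.length_cons]
    omega

/-- The stack has height at most `(n + 1) * (4 * n + 1) ≤ 10 * n ^ 2`, and each record holds at most
`4 * (4 * n) + 2 ≤ 18 * n` units, where `n` is the length of `φ₀`. -/
lemma ConfigInv.mem_le {V : Set P} {φ₀ : Form P} {c : Config P} (h : ConfigInv V φ₀ c)
    {k : LForm P → ℕ} {M : ℕ} (hM : 1 ≤ M) (hk : ∀ l, Admissible φ₀ l → k l ≤ M) :
    c.mem k ≤ 181 * φ₀.len ^ 3 * M := by
  obtain ⟨hf, hlen⟩ := h.stack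
  have hN := card_allowed_le φ₀
  have hpos : 1 ≤ φ₀.len := φ₀.size_pos fun _ => le_rfl
  have hsum : (c.stack.map (Frame.mem k)).sum ≤
      c.stack.length * (M * (4 * (allowed φ₀).card + 2)) := by
    have := List.sum_le_card_nsmul (c.stack.map (Frame.mem k)) (M * (4 * (allowed φ₀).card + 2))
      fun x hx => by
        obtain ⟨f, hfs, rfl⟩ := List.mem_map.1 hx
        obtain ⟨σ, hσ⟩ := hf f hfs
        exact hσ.mem_le hM hk
    simpa using this
  have h₁ : c.stack.length ≤ 2 * φ₀.len * (5 * φ₀.len) :=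
    hlen.trans (Nat.mul_le_mul (by omega) (by omega))
  have h₂ : M * (4 * (allowed φ₀).card + 2) ≤ M * (18 * φ₀.len) :=
    Nat.mul_le_mul_left _ (by omega)
  have h₃ : 1 ≤ φ₀.len ^ 3 * M := Nat.mul_pos (pow_pos hpos 3) hM
  calc c.mem k ≤ φ₀.len ^ 3 * M + 2 * φ₀.len * (5 * φ₀.len) * (M * (18 * φ₀.len)) :=
        add_le_add h₃ (hsum.trans (Nat.mul_le_mul h₁ h₂))
    _ = 181 * φ₀.len ^ 3 * M := by ring

/-- The size of the label and the size of the formula are both bounded by that of `φ₀`, up to a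
negation sign in front of a variable. -/
lemma Admissible.space_le {φ₀ : Form P} {l : LForm P} (h : Admissible φ₀ l) {ν : P → ℕ}
    (hν : ∀ p, 1 ≤ ν p) :
    1 + (l.1.map (Assign.size ν)).sum + l.2.size ν ≤ 4 * φ₀.size ν := by
  have hpos := φ₀.size_pos hν
  have hl := h.labelSize_le ν
  rw [labelSize] at hl
  rcases h.size_le with ⟨p, v, hp⟩ | hs
  · have hv : ν p ≤ φ₀.size ν := φ₀.le_size_of_mem_vars ν
      (h.vars_subset (by rw [hp]; cases v <;> simp [lit, Form.vars]))
    have : l.2.size ν ≤ 1 + ν p := by rw [hp]; cases v <;> simp [lit, Form.size]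
    omega
  · have := hs ν
    rw [labelSize] at this
    omega

end DLPA

end
theorem mainTheorem3 :
    ∃ C : ℕ, ∀ (P : Type u) (V : Set P) (φ₀ : DLPA.Form P), φ₀.StarFree →
      -- every execution halts
      (¬ ∃ c : ℕ → DLPA.Config P, c 0 = DLPA.initConfig V φ₀ ∧ ∀ n, DLPA.Step (c n) (c (n + 1))) ∧
      ∀ c : DLPA.Config P, DLPA.Reachable V φ₀ c →
        -- every execution that has come to an end has produced the correct answer
        ((∀ e, ¬ DLPA.Step c e) → ∃ v : Bool, c = .ret v [] ∧ (v = true ↔ φ₀.Sat V)) ∧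
        -- at every moment, the memory in use is polynomially bounded
        c.cells ≤ C * φ₀.len ^ 3 ∧
        ∀ ν : P → ℕ, (∀ p, 1 ≤ ν p) → c.space ν ≤ C * φ₀.len ^ 3 * φ₀.size ν := by
  -- `724 = 4 * 181`: a labelled formula takes at most `4 * φ₀.size ν` symbols.
  refine ⟨724, fun P V φ₀ hφ₀ => ⟨?_, fun c hc => ?_⟩⟩
  · rintro ⟨c, h₀, hs⟩
    have hinv : ∀ n, DLPA.ConfigInv V φ₀ (c n) := by
      intro n
      induction n with
      | zero => exact h₀ ▸ DLPA.configInv_init V hφ₀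
      | succ n ih => exact ih.step (hs n)
    obtain ⟨n, hn⟩ := WellFounded.not_rel_apply_succ (r := (· < · : ℕ → ℕ → Prop))
      fun n => (c n).weight φ₀
    exact hn ((hinv n).weight_lt (hs n))
  · have hinv : DLPA.ConfigInv V φ₀ c := by
      induction hc with
      | refl => exact DLPA.configInv_init V hφ₀
      | tail _ hs ih => exact ih.step hs
    refine ⟨hinv.eq_ret_of_forall_not_step, ?_, fun ν hν => ?_⟩
    · have := hinv.mem_le le_rfl (k := fun _ => 1) fun _ _ => le_rfl
      rw [DLPA.Config.cells]
      omega
    · have hpos := φ₀.size_pos hν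
      refine (hinv.mem_le (M := 4 * φ₀.size ν) (by omega) fun l hl => hl.space_le hν).trans ?_
      exact le_of_eq (by ring)
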